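/- Let $G$ be a finite simple graph on $N$ vertices, with a qubit at each vertex, and let $|\psi_G\rangle$ be its graph state (all qubits in $|+\rangle$, then a controlled-phase gate along each edge). For an $N$-qubit state $\rho$, the Divide and Rebuild Purification Protocol (DRPP) does the following. (i) For each edge $e=\{a,b\}$, all other qubits of $\rho$ are measured in the $Z$-basis and $Z$ is applied to an end of $e$ once for each of its measured neighbours with outcome $1$; this gives a two-qubit state $\rho_e$. (ii) For each edge $e$, stochastic local operations and classical communication (SLOCC) between the two ends are applied to many copies of $\rho_e$, giving a two-qubit state $\tau_e$. (iii) At each vertex the qubits held there, one per incident edge, are projected to one qubit by $|0\rangle\langle 0\cdots 0|+|1\rangle\langle 1\cdots1|$ (an isolated vertex is prepared in $|+\rangle$). We say that the DRPP purifies $\rho$ if for every $\varepsilon>0$ the SLOCC operations in (ii) can be chosen so that the final normalized state has fidelity greater than $1-\varepsilon$ with $|\psi_G\rangle$. Local depolarizing noise of rate $p\in[0,1]$ is the channel $\rho\mapsto(1-p)\rho+\frac p3(X\rho X+Y\rho Y+Z\rho Z)$ applied independently to every qubit. 1. For every integer $D\ge 0$ there is exactly one $p\in[0,3/4]$ such that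 $x=1-4p/3$ satisfies $x^{2D}+2x^{D+1}-1=0$. Denote it by $p_{\rm crit}(D)$. 2. Let $G$ be two-colorable with no vertex of degree greater than $D_G$. If $0\le p<p_{\rm crit}(D_G)$, the DRPP purifies the state obtained from $|\psi_G\rangle$ by local depolarizing noise of rate $p$. If moreover $G$ has two adjacent vertices which both have degree $D_G$, then the DRPP does not purify this state for any $p$ with $p_{\rm crit}(D_G)\le p\le1$. 3. Let $G$ be the graph of the Steane $[[7,1,3]]$ code, that is, the bipartite graph with classes of $3$ and $4$ vertices and biadjacency matrix $\begin{pmatrix}1&1&0&1\\1&0&1&1\\0&1&1&1\end{pmatrix}$. It is two-colorable with maximum degree $3$, and under local depolarizing noise of rate $p\in[0,1]$ the DRPP purifies if and only if $p<p_{\rm crit}(3)$, where $|p_{\rm crit}(3)-0.16|<0.0005$. 4. Let $G$ be any graph with at least one edge (for instance the linear cluster graph on $N\ge2$ vertices), let $x\ge-1$ be real and let $\rho=(\mathbb 1+x|\psi_G\rangle\langle\psi_G|)/(2^N+x)$ be the maximally depolarized graph state. Then the DRPP purifies $\rho$ if and only if $$\langle\psi_G|\rho|\psi_G\rangle>\frac13+\frac1{3\cdot2^{N-1}}.$$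 -/

import Mathlib

open scoped Matrix

noncomputable section

namespace DRPP

/-- (Possibly unnormalized) density operators of qubits labelled by `W`, as matrices in the
computational basis `W → Fin 2`. -/
abbrev QOp (W : Type*) := Matrix (W → Fin 2) (W → Fin 2) ℂ

/-- The fidelity `⟨ψ|ρ|ψ⟩ / tr ρ` of the state obtained by normalizing `ρ`
(`0` if the trace vanishes). -/
def fidelity {W : Type*} [Fintype W] [DecidableEq W] (ψ : (W → Fin 2) → ℂ) (ρ : QOp W) : ℝ :=
  (star ψ ⬝ᵥ (ρ *ᵥ ψ)).re / (ρ.trace).re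

/-! ### Graph states -/

/-- The graph state: every qubit in `|+⟩`, followed by a controlled-phase gate along each edge. -/
def graphState {V : Type*} [Fintype V] [DecidableEq V] (G : SimpleGraph V) [DecidableRel G.Adj]
    (z : V → Fin 2) : ℂ :=
  (1 / (Real.sqrt 2 : ℂ)) ^ Fintype.card V *
    ∏ e ∈ G.edgeFinset, if ∀ v ∈ e, z v = 1 then (-1 : ℂ) else 1

/-- The projector `|ψ_G⟩⟨ψ_G|`. -/
def graphProj {V : Type*} [Fintype V] [DecidableEq V] (G : SimpleGraph V) [DecidableRel G.Adj] :
    QOp V :=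
  Matrix.vecMulVec (graphState G) (star (graphState G))

/-! ### Noise models -/

/-- The Pauli matrices `𝟙, X, Y, Z`. -/
def pauli : Fin 4 → Matrix (Fin 2) (Fin 2) ℂ :=
  ![!![1, 0; 0, 1], !![0, 1; 1, 0], !![0, -Complex.I; Complex.I, 0], !![1, 0; 0, -1]]

/-- Probability of each single-qubit Pauli error: no error with probability `1 - p`, and each of
`X, Y, Z` with probability `p / 3`. -/
def errorProb (p : ℝ) : Fin 4 → ℝ := ![1 - p, p / 3, p / 3, p / 3]

/-- The tensor product over all qubits `v` of the Pauli matrices `s v`. -/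
def pauliString {V : Type*} [Fintype V] (s : V → Fin 4) : QOp V :=
  fun z w => ∏ v, pauli (s v) (z v) (w v)

/-- Local depolarizing noise: the channel
`ρ ↦ (1 - p) ρ + (p / 3) (X ρ X + Y ρ Y + Z ρ Z)` acting independently on every qubit. -/
def localDepolarize {V : Type*} [Fintype V] [DecidableEq V] (p : ℝ) (ρ : QOp V) : QOp V :=
  ∑ s : V → Fin 4, ((∏ v, errorProb p (s v) : ℝ) : ℂ) • (pauliString s * ρ * (pauliString s)ᴴ)

/-- The maximally (globally) depolarized graph state `(𝟙 + x |ψ_G⟩⟨ψ_G|) / (2 ^ N + x)`. -/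
def maxDepolarized {V : Type*} [Fintype V] [DecidableEq V] (G : SimpleGraph V)
    [DecidableRel G.Adj] (x : ℝ) : QOp V :=
  (1 / ((2 : ℂ) ^ Fintype.card V + (x : ℂ))) • (1 + (x : ℂ) • graphProj G)

/-! ### Divide: reduction to two-qubit states by `Z`-measurements -/

/-- The basis label which is `z` on the two ends of `e` and `s` on all other qubits. -/
def glue {V : Type*} [DecidableEq V] (e : Sym2 V) (z : {v // v ∈ e} → Fin 2)
    (s : {v // v ∉ e} → Fin 2) : V → Fin 2 :=
  fun v => if h : v ∈ e then z ⟨v, h⟩ else s ⟨v, h⟩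

/-- Kraus operator of the measurement in the `Z`-basis of all qubits off `e`, with outcome `s`,
followed by the correction: `Z` is applied to an end `v` of `e` once for every measured neighbour
`c` of `v` with outcome `s c = 1`. -/
def measureKraus {V : Type*} [Fintype V] [DecidableEq V] (G : SimpleGraph V) [DecidableRel G.Adj]
    (e : Sym2 V) (s : {v // v ∉ e} → Fin 2) :
    Matrix ({v // v ∈ e} → Fin 2) (V → Fin 2) ℂ :=
  fun z w => if w = glue e z s then
      ∏ v : {v // v ∈ e}, ∏ c : {v // v ∉ e},
        (if G.Adj v.1 c.1 ∧ z v = 1 ∧ s c = 1 then (-1 : ℂ) else 1)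
    else 0

/-- The two-qubit state on the ends of `e` that results from measuring all other qubits of `ρ` in
the `Z`-basis and correcting according to the outcomes. -/
def measuredPair {V : Type*} [Fintype V] [DecidableEq V] (G : SimpleGraph V) [DecidableRel G.Adj]
    (e : Sym2 V) (ρ : QOp V) : QOp {v // v ∈ e} :=
  ∑ s : {v // v ∉ e} → Fin 2, measureKraus G e s * ρ * (measureKraus G e s)ᴴ

/-! ### Purification of two-qubit states by SLOCC -/

/-- `n` copies of `ρ`; party `v` holds its qubit from every copy. -/
def copies {W : Type*} (n : ℕ) (ρ : QOp W) :
    Matrix (W → Fin n → Fin 2) (W → Fin n → Fin 2) ℂ :=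
  fun x y => ∏ i, ρ (fun v => x v i) (fun v => y v i)

/-- The product operator in which every party `v` applies `A v` to its `n` qubits, leaving one. -/
def localKraus {W : Type*} [Fintype W] {n : ℕ} (A : W → Matrix (Fin 2) (Fin n → Fin 2) ℂ) :
    Matrix (W → Fin 2) (W → Fin n → Fin 2) ℂ :=
  fun z x => ∏ v, A v (z v) (x v)

/-- `τ` is, up to normalization, a possible result of stochastic local operations and classical
communication on finitely many copies of `ρ`: it is the image of `ρ^{⊗ n}` under a map with product
Kraus operators. (A protocol with post-selection has this form, and conversely every such map is
carried out, with nonzero probability, by choosing `k` with shared randomness and applying the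
local filters `A k v`, suitably scaled.) -/
def SLOCCOutput {W : Type*} [Fintype W] [DecidableEq W] (ρ τ : QOp W) : Prop :=
  ∃ (n K : ℕ) (A : Fin K → W → Matrix (Fin 2) (Fin n → Fin 2) ℂ),
    τ = ∑ k, localKraus (A k) * copies n ρ * (localKraus (A k))ᴴ

/-! ### Rebuild -/

/-- At every vertex, project all qubits held there (one for each incident edge) to one qubit with
`|0⟩⟨0⋯0| + |1⟩⟨1⋯1|`. At an isolated vertex this prepares `|0⟩ + |1⟩`. -/
def rebuildKraus {V : Type*} [Fintype V] [DecidableEq V] (G : SimpleGraph V)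
    [DecidableRel G.Adj] :
    Matrix (V → Fin 2) ((e : G.edgeSet) → {v // v ∈ e.1} → Fin 2) ℂ :=
  fun z w => if ∀ (e : G.edgeSet) (v : {v // v ∈ e.1}), w e v = z v.1 then 1 else 0

/-- The tensor product of the two-qubit states `τ e`, one for each edge. -/
def edgeTensor {V : Type*} [Fintype V] [DecidableEq V] (G : SimpleGraph V) [DecidableRel G.Adj]
    (τ : (e : G.edgeSet) → QOp {v // v ∈ e.1}) :
    Matrix ((e : G.edgeSet) → {v // v ∈ e.1} → Fin 2)
      ((e : G.edgeSet) → {v // v ∈ e.1} → Fin 2) ℂ :=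
  fun w w' => ∏ e, τ e (w e) (w' e)

/-- The (unnormalized) state built from the two-qubit states `τ e`. -/
def rebuild {V : Type*} [Fintype V] [DecidableEq V] (G : SimpleGraph V) [DecidableRel G.Adj]
    (τ : (e : G.edgeSet) → QOp {v // v ∈ e.1}) : QOp V :=
  rebuildKraus G * edgeTensor G τ * (rebuildKraus G)ᴴ

/-- The Divide and Rebuild Purification Protocol purifies `ρ` to `|ψ_G⟩`: by SLOCC on many copies
of the measured two-qubit state of each edge one can produce two-qubit states from which the graph
state is rebuilt with fidelity arbitrarily close to one. -/
def Purifies {V : Type*} [Fintype V] [DecidableEq V] (G : SimpleGraph V) [DecidableRel G.Adj]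
    (ρ : QOp V) : Prop :=
  ∀ ε : ℝ, 0 < ε → ∃ τ : (e : G.edgeSet) → QOp {v // v ∈ e.1},
    (∀ e, SLOCCOutput (measuredPair G e.1 ρ) (τ e)) ∧
      1 - ε < fidelity (graphState G) (rebuild G τ)

/-! ### The critical error rate and the graph of the Steane code -/

/-- `p ∈ [0, 3/4]` and `x = 1 - 4 p / 3` is a root of `x ^ (2 D) + 2 x ^ (D + 1) - 1`. -/
def IsCriticalRate (D : ℕ) (p : ℝ) : Prop :=
  p ∈ Set.Icc (0 : ℝ) (3 / 4) ∧
    (1 - 4 * p / 3) ^ (2 * D) + 2 * (1 - 4 * p / 3) ^ (D + 1) - 1 = 0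

/-- `[𝟙 | steaneMatrix]` generates the dual of the `[7,4]` Hamming code: its columns are the seven
nonzero vectors of `𝔽₂³`. -/
def steaneMatrix : Matrix (Fin 3) (Fin 4) (ZMod 2) :=
  !![1, 1, 0, 1; 1, 0, 1, 1; 0, 1, 1, 1]

/-- The bipartite graph on seven vertices with biadjacency matrix `steaneMatrix`. Hadamard gates on
the qubits of the second class map its graph state to the uniform superposition of the words of the
dual Hamming code, which is the logical `|0⟩` of the Steane [[7,1,3]] code. -/
def steaneGraph : SimpleGraph (Fin 3 ⊕ Fin 4) where
  Adj
    | .inl i, .inr j => steaneMatrix i j = 1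
    | .inr j, .inl i => steaneMatrix i j = 1
    | _, _ => False
  symm := ⟨by rintro (a | a) (b | b) h <;> exact h⟩
  loopless := ⟨by rintro (a | a) h <;> exact h⟩

instance : DecidableRel steaneGraph.Adj := fun a b =>
  match a, b with
  | .inl i, .inr j => inferInstanceAs (Decidable (steaneMatrix i j = 1))
  | .inr j, .inl i => inferInstanceAs (Decidable (steaneMatrix i j = 1))
  | .inl _, .inl _ => isFalse fun h => h
  | .inr _, .inr _ => isFalse fun h => h

end DRPP

end

namespace DRPP

open scoped ComplexOrder

/-! ### Positivity of entrywise products and product operators -/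

/-! Everything reduces to two-qubit states. After the `Z`-measurements the pair on an edge is
diagonal in the graph-state basis of that edge (`pairState`), hence fixed by three stabilizer
expectations `A`, `B`, `C`. Partial transposition only flips the sign of `C`, and the threshold is
`A + B + C = 1`, that is, fidelity `1/2`.

Above the threshold an explicit filter protocol works (`bell_mem_closure`). A Hadamard gate turns
the pair into a matrix supported on the diagonal and antidiagonal, and projecting `n` copies to one
takes entrywise powers. Two rounds of powers with Hadamard gates between them suppress both kinds of
error (`exists_pow_purification`). Fidelity is continuous in the rebuilt state, so approximating the
perfect pair on every edge suffices (`purifies_of_mem_closure`).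

Below it, a single edge `ab` with positive partial transpose blocks the whole protocol. SLOCC
preserves this property, and so does rebuilding conditioned on the `Z`-values of the other qubits:
rebuilding is an entrywise product, and every other edge contains at most one of `a`, `b`
(`partialTranspose_block_posSemidef`). Each conditional block then has overlap at most `1/2` with
the maximally entangled state, and a Cauchy–Schwarz argument over the blocks bounds the global
fidelity by `1/2` (`fidelity_rebuild_le_half`).

It remains to compute the pairs. Depolarizing noise with `x = 1 - 4p/3` scales a Pauli string of
weight `w` by `x ^ w`. Without common neighbours the three stabilizers have weights `deg a + 1`,
`deg b + 1` and `deg a + deg b`, so two ends of degree `D` give the polynomial in the theorem.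
Global depolarization gives `A = B = C = x / (2^N + x)`, with `x` now its own parameter, on every
graph. -/

/-- Schur product theorem, iterated; the empty product is the all-ones matrix, which has rank one.
Both copies of a state and rebuilding are entrywise products of submatrices, so this yields their
positivity. -/
theorem posSemidef_prod {ι n : Type*} [Finite n] (s : Finset ι) (M : ι → Matrix n n ℂ)
    (h : ∀ i ∈ s, (M i).PosSemidef) :
    (Matrix.of fun x y => ∏ i ∈ s, M i x y).PosSemidef := by
  classical
  have := Fintype.ofFinite n
  induction s using Finset.induction_on with
  | empty =>
    have := Matrix.posSemidef_vecMulVec_self_star (R := ℂ) (fun _ : n => (1 : ℂ))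
    convert this using 1
    ext x y
    simp [Matrix.vecMulVec]
  | insert i s hi ih =>
    have h1 : (M i ⊙ Matrix.of fun x y => ∏ i ∈ s, M i x y).PosSemidef :=
      (h i (by simp)).hadamard (ih fun j hj => h j (by simp [hj]))
    have h2 : (Matrix.of fun x y => ∏ j ∈ insert i s, M j x y) =
        M i ⊙ Matrix.of fun x y => ∏ j ∈ s, M j x y := by
      ext x y
      simp [hi]
    rw [h2]
    exact h1

/-- The tensor product of the matrices `A v`. -/
def prodKraus {W α β : Type*} [Fintype W] (A : W → Matrix α β ℂ) : Matrix (W → α) (W → β) ℂ :=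
  fun z x => ∏ v, A v (z v) (x v)

theorem prodKraus_mul {W α β γ : Type*} [Fintype W] [DecidableEq W] [Fintype β]
    (A : W → Matrix α β ℂ) (B : W → Matrix β γ ℂ) :
    prodKraus A * prodKraus B = prodKraus fun v => A v * B v := by
  ext z x
  simp only [prodKraus, Matrix.mul_apply, Fintype.prod_sum, Finset.prod_mul_distrib]

theorem prodKraus_conjTranspose {W α β : Type*} [Fintype W] (A : W → Matrix α β ℂ) :
    (prodKraus A)ᴴ = prodKraus fun v => (A v)ᴴ := by
  ext z x
  simp [prodKraus]

/-! ### Partial transposition -/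

/-- Transposition of the tensor factor `b`. -/
def partialTranspose {W α : Type*} [DecidableEq W] (b : W) (M : Matrix (W → α) (W → α) ℂ) :
    Matrix (W → α) (W → α) ℂ :=
  fun z w => M (Function.update z b (w b)) (Function.update w b (z b))

/-- Exchange of the entries at `b` of two labels. -/
def swapAt {W α : Type*} [DecidableEq W] (b : W) : (W → α) × (W → α) ≃ (W → α) × (W → α) where
  toFun q := (Function.update q.1 b (q.2 b), Function.update q.2 b (q.1 b))
  invFun q := (Function.update q.1 b (q.2 b), Function.update q.2 b (q.1 b))
  left_inv q := by simp
  right_inv q := by simp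

/-- Transposing `A M Aᴴ` replaces `A` by its entrywise conjugate; doing so on one tensor factor
changes only that party's operator. Product Kraus maps therefore commute with partial transposition
up to a change of Kraus operator. -/
theorem partialTranspose_conj {W α β : Type*} [Fintype W] [DecidableEq W] [Fintype β]
    (b : W) (A : W → Matrix α β ℂ) (M : Matrix (W → β) (W → β) ℂ) :
    partialTranspose b (prodKraus A * M * (prodKraus A)ᴴ) =
      prodKraus (Function.update A b ((A b).map star)) * partialTranspose b M *
        (prodKraus (Function.update A b ((A b).map star)))ᴴ := by
  ext z w
  have key : ∀ (A : W → Matrix α β ℂ) (M : Matrix (W → β) (W → β) ℂ) (z w : W → α),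
      (prodKraus A * M * (prodKraus A)ᴴ) z w =
        ∑ q : (W → β) × (W → β), prodKraus A z q.1 * M q.1 q.2 * star (prodKraus A w q.2) := by
    intro A M z w
    simp only [Matrix.mul_apply, Finset.sum_mul, Fintype.sum_prod_type, Matrix.conjTranspose_apply]
    rw [Finset.sum_comm]
  rw [partialTranspose, key, key]
  refine Fintype.sum_equiv (swapAt b) _ _ fun q => ?_
  obtain ⟨x, y⟩ := q
  have h1 : prodKraus A (Function.update z b (w b)) x *
        star (prodKraus A (Function.update w b (z b)) y) =
      prodKraus (Function.update A b ((A b).map star)) z (Function.update x b (y b)) *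
        star (prodKraus (Function.update A b ((A b).map star)) w (Function.update y b (x b))) := by
    simp only [prodKraus, star_prod, ← Finset.prod_mul_distrib]
    refine Finset.prod_congr rfl fun v _ => ?_
    rcases eq_or_ne v b with rfl | hv
    · simp [mul_comm]
    · simp [hv]
  simp only [swapAt, Equiv.coe_fn_mk, partialTranspose, Function.update_self, Function.update_idem,
    Function.update_eq_self]
  rw [mul_right_comm, h1, mul_right_comm]

/-! ### Stochastic local operations preserve positivity and positive partial transposes -/

theorem copies_posSemidef {W : Type*} [Finite W] (n : ℕ) {ρ : QOp W} (h : ρ.PosSemidef) :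
    (copies n ρ).PosSemidef :=
  posSemidef_prod Finset.univ
    (fun i : Fin n => ρ.submatrix (fun x : W → Fin n → Fin 2 => fun v => x v i) fun x v => x v i)
    fun _ _ => h.submatrix _

theorem SLOCCOutput.posSemidef {W : Type*} [Fintype W] [DecidableEq W] {ρ τ : QOp W}
    (h : SLOCCOutput ρ τ) (hρ : ρ.PosSemidef) : τ.PosSemidef := by
  obtain ⟨n, K, A, rfl⟩ := h
  exact Matrix.posSemidef_sum _ fun k _ => (copies_posSemidef n hρ).mul_mul_conjTranspose_same _

theorem partialTranspose_copies {W : Type*} [DecidableEq W] (n : ℕ) (b : W) (ρ : QOp W) :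
    partialTranspose b (copies n ρ) = copies n (partialTranspose b ρ) := by
  ext x y
  simp only [partialTranspose, copies]
  refine Finset.prod_congr rfl fun i _ => ?_
  congr 1 <;> ext v <;> rcases eq_or_ne v b with rfl | hv <;> simp [*]

theorem SLOCCOutput.partialTranspose_posSemidef {W : Type*} [Fintype W] [DecidableEq W]
    {ρ τ : QOp W} (h : SLOCCOutput ρ τ) (b : W) (hρ : (partialTranspose b ρ).PosSemidef) :
    (partialTranspose b τ).PosSemidef := by
  obtain ⟨n, K, A, rfl⟩ := h
  have h1 : partialTranspose b (∑ k, localKraus (A k) * copies n ρ * (localKraus (A k))ᴴ) =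
      ∑ k, partialTranspose b (prodKraus (A k) * copies n ρ * (prodKraus (A k))ᴴ) := by
    ext z w
    simp only [partialTranspose, Matrix.sum_apply]
    rfl
  rw [h1]
  refine Matrix.posSemidef_sum _ fun k _ => ?_
  rw [partialTranspose_conj, partialTranspose_copies]
  exact (copies_posSemidef n hρ).mul_mul_conjTranspose_same _

/-! ### Composition of local filters -/

/-- `τ` is obtained from copies of `ρ` by one local filter at each party. -/
def FilterOutput {W : Type*} [Fintype W] [DecidableEq W] (ρ τ : QOp W) : Prop :=
  ∃ (n : ℕ) (A : W → Matrix (Fin 2) (Fin n → Fin 2) ℂ),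
    τ = localKraus A * copies n ρ * (localKraus A)ᴴ

theorem FilterOutput.sloccOutput {W : Type*} [Fintype W] [DecidableEq W] {ρ τ : QOp W}
    (h : FilterOutput ρ τ) : SLOCCOutput ρ τ := by
  obtain ⟨n, A, rfl⟩ := h
  exact ⟨n, 1, fun _ => A, by simp⟩

/-- This makes filter protocols composable: `m` runs on `n` copies each amount to one product
operator on `m * n` copies. -/
theorem copies_conj {W : Type*} [Fintype W] [DecidableEq W] (m n : ℕ)
    (A : W → Matrix (Fin 2) (Fin n → Fin 2) ℂ) (ρ : QOp W) :
    copies m (localKraus A * copies n ρ * (localKraus A)ᴴ) =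
      prodKraus (fun v => Matrix.of fun (u : Fin m → Fin 2) (x : Fin (m * n) → Fin 2) =>
          ∏ i, A v (u i) fun j => x (finProdFinEquiv (i, j))) * copies (m * n) ρ *
        (prodKraus (fun v => Matrix.of fun (u : Fin m → Fin 2) (x : Fin (m * n) → Fin 2) =>
          ∏ i, A v (u i) fun j => x (finProdFinEquiv (i, j))))ᴴ := by
  let E : (W → Fin (m * n) → Fin 2) ≃ (Fin m → W → Fin n → Fin 2) :=
    { toFun := fun x i v j => x v (finProdFinEquiv (i, j))
      invFun := fun y v k => y (finProdFinEquiv.symm k).1 v (finProdFinEquiv.symm k).2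
      left_inv := fun x => by
        funext v k
        exact congrArg (x v) (finProdFinEquiv.apply_symm_apply k)
      right_inv := fun y => by ext i v j; simp }
  -- The runs are treated as tensor factors indexed by `Fin m`, so that `prodKraus_mul` applies; `E`
  -- then exchanges the roles of run and party.
  have h1 := prodKraus_mul (fun _ : Fin m => localKraus A) (fun _ => copies n ρ)
  have h2 := prodKraus_mul (fun _ : Fin m => localKraus A * copies n ρ)
    (fun _ => (localKraus A)ᴴ)
  rw [← h1, ← prodKraus_conjTranspose] at h2
  ext X Y
  have h3 := congrFun (congrFun h2 fun i v => X v i) fun i v => Y v i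
  refine Eq.trans (Eq.symm (Eq.trans h3 rfl)) ?_
  simp only [Matrix.mul_apply, Matrix.conjTranspose_apply]
  have hL : ∀ (X : W → Fin m → Fin 2) (x : W → Fin (m * n) → Fin 2),
      prodKraus (fun _ : Fin m => localKraus A) (fun i v => X v i) (E x) =
        prodKraus (fun v => Matrix.of fun (u : Fin m → Fin 2) (x : Fin (m * n) → Fin 2) =>
          ∏ i, A v (u i) fun j => x (finProdFinEquiv (i, j))) X x := by
    intro X x
    simp only [prodKraus, localKraus, Matrix.of_apply]
    rw [Finset.prod_comm]
    rfl
  have hC : ∀ x y : W → Fin (m * n) → Fin 2,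
      prodKraus (fun _ : Fin m => copies n ρ) (E x) (E y) = copies (m * n) ρ x y := by
    intro x y
    simp only [prodKraus, copies]
    rw [← Fintype.prod_prod_type']
    exact Fintype.prod_equiv finProdFinEquiv _ _ fun _ => rfl
  symm
  refine Fintype.sum_equiv E _ _ fun y => ?_
  rw [hL Y y]
  congr 1
  refine Fintype.sum_equiv E _ _ fun x => ?_
  rw [hL X x, hC]

theorem FilterOutput.trans {W : Type*} [Fintype W] [DecidableEq W] {ρ σ τ : QOp W}
    (h : FilterOutput ρ σ) (h' : FilterOutput σ τ) : FilterOutput ρ τ := by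
  obtain ⟨n, A, rfl⟩ := h
  obtain ⟨m, B, rfl⟩ := h'
  refine ⟨m * n, fun v => B v * Matrix.of fun (u : Fin m → Fin 2) (x : Fin (m * n) → Fin 2) =>
          ∏ i, A v (u i) fun j => x (finProdFinEquiv (i, j)), ?_⟩
  rw [copies_conj]
  have h1 := prodKraus_mul B fun v => Matrix.of fun (u : Fin m → Fin 2)
    (x : Fin (m * n) → Fin 2) => ∏ i, A v (u i) fun j => x (finProdFinEquiv (i, j))
  have h2 : ∀ (k : ℕ) (A : W → Matrix (Fin 2) (Fin k → Fin 2) ℂ), localKraus A = prodKraus A :=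
    fun _ _ => rfl
  rw [h2, h2, ← h1, Matrix.conjTranspose_mul]
  simp only [Matrix.mul_assoc]

theorem filterOutput_conj {W : Type*} [Fintype W] [DecidableEq W] (ρ : QOp W)
    (U : W → Matrix (Fin 2) (Fin 2) ℂ) :
    FilterOutput ρ (prodKraus U * ρ * (prodKraus U)ᴴ) := by
  refine ⟨1, fun v => (U v).submatrix id fun x => x 0, ?_⟩
  let E : (W → Fin 1 → Fin 2) ≃ (W → Fin 2) :=
    { toFun := fun x v => x v 0
      invFun := fun x v _ => x v
      left_inv := fun x => by ext v i; fin_cases i; rfl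
      right_inv := fun x => rfl }
  ext z w
  simp only [Matrix.mul_apply, Matrix.conjTranspose_apply]
  refine (Fintype.sum_equiv E _ _ fun y => ?_).symm
  congr 1
  refine Fintype.sum_equiv E _ _ fun x => ?_
  simp [localKraus, prodKraus, copies, E]

theorem filterOutput_smul {W : Type*} [Fintype W] [DecidableEq W] [Nonempty W] (ρ : QOp W)
    {c : ℝ} (hc : 0 ≤ c) : FilterOutput ρ ((c : ℂ) • ρ) := by
  obtain ⟨v₀⟩ := ‹Nonempty W›
  -- One party alone carries the factor `√c`, which enters twice in the conjugation.
  convert filterOutput_conj ρ (fun v => if v = v₀ then ((Real.sqrt c : ℝ) : ℂ) • 1 else 1) using 1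
  have h : prodKraus (fun v : W => if v = v₀ then ((Real.sqrt c : ℝ) : ℂ) •
      (1 : Matrix (Fin 2) (Fin 2) ℂ) else 1) = ((Real.sqrt c : ℝ) : ℂ) • (1 : QOp W) := by
    ext z w
    have : ∀ v, (if v = v₀ then ((Real.sqrt c : ℝ) : ℂ) • (1 : Matrix (Fin 2) (Fin 2) ℂ) else 1)
        (z v) (w v) =
          (if v = v₀ then ((Real.sqrt c : ℝ) : ℂ) else 1) * if z v = w v then 1 else 0 := by
      intro v
      rw [← Matrix.one_apply]
      split_ifs <;> simp
    simp only [prodKraus, this, Finset.prod_mul_distrib, Finset.prod_ite_eq', Finset.mem_univ,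
      if_true, Matrix.smul_apply, Matrix.one_apply, smul_eq_mul, Finset.prod_ite_zero,
      Finset.prod_const_one, funext_iff, true_imp_iff]
  rw [h]
  simp only [smul_mul_assoc, one_mul, Matrix.conjTranspose_smul, Matrix.conjTranspose_one,
    mul_smul_comm, mul_one, smul_smul]
  congr 1
  rw [Complex.star_def, Complex.conj_ofReal, ← Complex.ofReal_mul, Real.mul_self_sqrt hc]

/-- Projecting `n` qubits of each party to one by `|0⟩⟨0⋯0| + |1⟩⟨1⋯1|` takes entrywise powers. -/
theorem filterOutput_pow {W : Type*} [Fintype W] [DecidableEq W] (ρ : QOp W) {n : ℕ} :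
    FilterOutput ρ (Matrix.of fun z w => ρ z w ^ n) := by
  refine ⟨n, fun _ => Matrix.of fun z x => if x = fun _ => z then 1 else 0, ?_⟩
  have h : ∀ (z : W → Fin 2) (x : W → Fin n → Fin 2),
      localKraus (fun _ : W => (Matrix.of fun (z : Fin 2) (x : Fin n → Fin 2) =>
        if x = fun _ => z then (1 : ℂ) else 0)) z x = if x = fun v _ => z v then 1 else 0 := by
    intro z x
    simp only [localKraus, Matrix.of_apply, Finset.prod_ite_zero, Finset.prod_const_one,
      Finset.mem_univ, true_imp_iff]
    simp only [funext_iff]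
  ext z w
  simp only [Matrix.mul_apply, Matrix.conjTranspose_apply, h]
  simp [copies]

/-! ### States of two qubits -/

/-- The sign of a basis label under a controlled-phase gate acting on all qubits of `W`. -/
def phaseSign {W : Type*} [Fintype W] (z : W → Fin 2) : ℂ :=
  if ∀ v, z v = 1 then -1 else 1

/-- The two-qubit state with stabilizer expectations `A = ⟨X_a Z_b⟩`, `B = ⟨Z_a X_b⟩` and
`C = ⟨Y_a Y_b⟩`. -/
noncomputable def pairState {W : Type*} [Fintype W] (a b : W) (A B C : ℝ) : QOp W := fun z w =>
  phaseSign z * phaseSign w *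
    (((if z a = w a then if z b = w b then 1 else B else if z b = w b then A else C : ℝ)) : ℂ) / 4

/-- The two-qubit state that is supported on the diagonal and the antidiagonal, with entries
depending on the parity of the row label. -/
def xState {W : Type*} (a b : W) (α β γ δ : ℝ) : QOp W := fun z w =>
  ((if z a = w a then (if z b = w b then (if z a = z b then α else β) else 0)
    else if z b = w b then 0 else if z a = z b then γ else δ : ℝ) : ℂ)

/-- The unnormalized Hadamard matrix. -/
def hadMatrix : Matrix (Fin 2) (Fin 2) ℂ := !![1, 1; 1, -1]

section Pair

variable {W : Type*} {a b : W}

theorem eq_iff_pair (hW : ∀ v, v = a ∨ v = b) {z w : W → Fin 2} :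
    z = w ↔ z a = w a ∧ z b = w b := by
  refine ⟨fun h => by simp [h], fun h => funext fun v => ?_⟩
  rcases hW v with rfl | rfl
  exacts [h.1, h.2]

variable [Fintype W]

theorem phaseSign_eq (hW : ∀ v, v = a ∨ v = b) (z : W → Fin 2) :
    phaseSign z = if z a = 1 ∧ z b = 1 then -1 else 1 := by
  have : (∀ v, z v = 1) ↔ z a = 1 ∧ z b = 1 := by
    refine ⟨fun h => ⟨h a, h b⟩, fun h v => ?_⟩
    rcases hW v with rfl | rfl
    exacts [h.1, h.2]
  simp only [phaseSign, this]

/-- The four hypotheses are the eigenvalues up to a factor `4`; the eigenvectors `u (±1) (±1)` are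
the graph state with `Z` applied to some of its qubits. They have squared norm `4`, hence the
denominators `16`. -/
theorem pairState_posSemidef (hW : ∀ v, v = a ∨ v = b) {A B C : ℝ}
    (h₁ : 0 ≤ 1 + A + B + C) (h₂ : 0 ≤ 1 + A - B - C) (h₃ : 0 ≤ 1 - A + B - C)
    (h₄ : 0 ≤ 1 - A - B + C) : (pairState a b A B C).PosSemidef := by
  let u : ℂ → ℂ → (W → Fin 2) → ℂ := fun s t z =>
    phaseSign z * ((if z a = 1 then s else 1) * if z b = 1 then t else 1)
  have h : pairState a b A B C =
      ((1 + A + B + C) / 16 : ℝ) • Matrix.vecMulVec (u 1 1) (star (u 1 1)) +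
      ((1 + A - B - C) / 16 : ℝ) • Matrix.vecMulVec (u 1 (-1)) (star (u 1 (-1))) +
      ((1 - A + B - C) / 16 : ℝ) • Matrix.vecMulVec (u (-1) 1) (star (u (-1) 1)) +
      ((1 - A - B + C) / 16 : ℝ) • Matrix.vecMulVec (u (-1) (-1)) (star (u (-1) (-1))) := by
    ext z w
    simp only [pairState, u, phaseSign_eq hW, Matrix.add_apply, Matrix.smul_apply,
      Matrix.vecMulVec_apply, Pi.star_apply]
    generalize z a = i; generalize z b = j; generalize w a = k; generalize w b = l
    fin_cases i <;> fin_cases j <;> fin_cases k <;> fin_cases l <;> simp <;> ring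
  rw [h]
  exact (((((Matrix.posSemidef_vecMulVec_self_star _).smul (by positivity)).add
    ((Matrix.posSemidef_vecMulVec_self_star _).smul (by positivity))).add
    ((Matrix.posSemidef_vecMulVec_self_star _).smul (by positivity))).add
    ((Matrix.posSemidef_vecMulVec_self_star _).smul (by positivity)))

variable [DecidableEq W]

theorem univ_eq_pair (hW : ∀ v, v = a ∨ v = b) : (Finset.univ : Finset W) = {a, b} := by
  ext v
  simpa using hW v

theorem prod_pair_univ (hab : a ≠ b) (hW : ∀ v, v = a ∨ v = b) (f : W → ℂ) :
    ∏ v, f v = f a * f b := by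
  rw [univ_eq_pair hW, Finset.prod_pair hab]

theorem sum_pair_univ (hab : a ≠ b) (hW : ∀ v, v = a ∨ v = b) (f : (W → Fin 2) → ℂ) :
    ∑ z, f z = ∑ i, ∑ j, f fun v => if v = a then i else j := by
  rw [← Fintype.sum_prod_type']
  refine Fintype.sum_equiv
    { toFun := fun z => (z a, z b)
      invFun := fun q v => if v = a then q.1 else q.2
      left_inv := fun z => ?_
      right_inv := fun q => by simp [hab.symm] } _ _ fun z => ?_
  · rw [eq_iff_pair hW]
    simp [hab.symm]
  · congr 1
    rw [eq_iff_pair hW]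
    simp [hab.symm]

/-- Of the Pauli matrices only `Y` changes sign under transposition, and among the three stabilizers
only `Y_a Y_b` has `Y` on `b`. -/
theorem partialTranspose_pairState (hab : a ≠ b) (hW : ∀ v, v = a ∨ v = b) (A B C : ℝ) :
    partialTranspose b (pairState a b A B C) = pairState a b A B (-C) := by
  ext z w
  simp only [pairState, partialTranspose, phaseSign_eq hW, Function.update_self,
    Function.update_of_ne hab]
  generalize z a = i; generalize z b = j; generalize w a = k; generalize w b = l
  fin_cases i <;> fin_cases j <;> fin_cases k <;> fin_cases l <;> simp

/-- A two-qubit operator with positive partial transpose has fidelity at most `1 / 2` with the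
maximally entangled state `∑ z, phaseSign z |z⟩ / 2`. -/
theorem sum_phaseSign_le_trace (hab : a ≠ b) (hW : ∀ v, v = a ∨ v = b) {M : QOp W}
    (hM : (partialTranspose b M).PosSemidef) :
    (∑ z, ∑ w, phaseSign z * M z w * phaseSign w).re ≤ 2 * M.trace.re := by
  -- The maximally entangled vector `Z_a Z_b` applied to the target: partial transposition turns its
  -- projector into a combination of the identity and the target's projector, with negative weight
  -- on the latter.
  let φ : (W → Fin 2) → ℂ := fun z =>
    phaseSign z * ((if z a = 1 then -1 else 1) * if z b = 1 then -1 else 1)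
  have h := (Matrix.posSemidef_iff_dotProduct_mulVec.mp hM).2 φ
  have h1 : star φ ⬝ᵥ (partialTranspose b M *ᵥ φ) =
      2 * M.trace - ∑ z, ∑ w, phaseSign z * M z w * phaseSign w := by
    have ht : M.trace = ∑ z, ∑ w, if z = w then M z w else 0 := by
      simp [Matrix.trace]
    rw [ht]
    simp only [dotProduct, Matrix.mulVec, Finset.mul_sum, ← Finset.sum_sub_distrib,
      ← Fintype.sum_prod_type']
    refine Fintype.sum_equiv (swapAt b) _ _ fun q => ?_
    obtain ⟨z, w⟩ := q
    simp only [φ, swapAt, partialTranspose, Equiv.coe_fn_mk, phaseSign_eq hW, eq_iff_pair hW,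
      Pi.star_apply, Function.update_self, Function.update_of_ne hab]
    generalize M _ _ = m
    generalize z a = i; generalize z b = j; generalize w a = k; generalize w b = l
    fin_cases i <;> fin_cases j <;> fin_cases k <;> fin_cases l <;> simp <;> ring
  rw [h1] at h
  have h2 := (Complex.le_def.mp h).1
  simp only [Complex.zero_re, Complex.sub_re, Complex.mul_re, Complex.re_ofNat, Complex.im_ofNat,
    zero_mul, sub_zero] at h2
  linarith

/-! ### Hadamard gates -/

theorem prodKraus_pair_conj (hab : a ≠ b) (hW : ∀ v, v = a ∨ v = b)
    (U : W → Matrix (Fin 2) (Fin 2) ℂ) (M : QOp W) (z w : W → Fin 2) :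
    (prodKraus U * M * (prodKraus U)ᴴ) z w = ∑ i, ∑ j, ∑ k, ∑ l,
      U a (z a) k * U b (z b) l * M (fun v => if v = a then k else l)
        (fun v => if v = a then i else j) * star (U a (w a) i * U b (w b) j) := by
  simp only [Matrix.mul_apply, sum_pair_univ hab hW, Matrix.conjTranspose_apply, prodKraus,
    prod_pair_univ hab hW, if_true, if_neg hab.symm, Finset.sum_mul]

theorem hadamard_conj_pairState (hab : a ≠ b) (hW : ∀ v, v = a ∨ v = b) (A B C : ℝ) :
    prodKraus (fun v => if v = b then hadMatrix else 1) * pairState a b A B C *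
      (prodKraus (fun v => if v = b then hadMatrix else 1))ᴴ =
      xState a b ((1 + B) / 2) ((1 - B) / 2) ((A + C) / 2) ((A - C) / 2) := by
  ext z w
  rw [prodKraus_pair_conj hab hW]
  simp only [pairState, xState, phaseSign_eq hW, if_true, if_neg hab.symm, if_neg hab,
    Fin.sum_univ_two, hadMatrix, Matrix.one_apply]
  generalize z a = i; generalize z b = j; generalize w a = k; generalize w b = l
  fin_cases i <;> fin_cases j <;> fin_cases k <;> fin_cases l <;> simp <;> ring

theorem hadamard_conj_xState_bell (hab : a ≠ b) (hW : ∀ v, v = a ∨ v = b) :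
    prodKraus (fun v => if v = b then hadMatrix else 1) * xState a b 1 0 1 0 *
      (prodKraus (fun v => if v = b then hadMatrix else 1))ᴴ =
      (4 : ℂ) • pairState a b 1 1 1 := by
  ext z w
  rw [prodKraus_pair_conj hab hW]
  simp only [pairState, xState, phaseSign_eq hW, if_true, if_neg hab.symm, if_neg hab,
    Fin.sum_univ_two, hadMatrix, Matrix.one_apply, Matrix.smul_apply]
  generalize z a = i; generalize z b = j; generalize w a = k; generalize w b = l
  fin_cases i <;> fin_cases j <;> fin_cases k <;> fin_cases l <;> norm_num

/-- A Fourier transform on the four parameters. It lets a second round of entrywise powers act on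
the errors that the first round leaves. -/
theorem hadamard_conj_xState (hab : a ≠ b) (hW : ∀ v, v = a ∨ v = b) (α β γ δ : ℝ) :
    prodKraus (fun _ => hadMatrix) * xState a b α β γ δ * (prodKraus (fun _ : W => hadMatrix))ᴴ =
      xState a b (2 * (α + β + γ + δ)) (2 * (α + β - γ - δ)) (2 * (α - β + γ - δ))
        (2 * (α - β - γ + δ)) := by
  ext z w
  rw [prodKraus_pair_conj hab hW]
  simp only [xState, if_true, if_neg hab.symm, Fin.sum_univ_two, hadMatrix]
  generalize z a = i; generalize z b = j; generalize w a = k; generalize w b = l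
  fin_cases i <;> fin_cases j <;> fin_cases k <;> fin_cases l <;> simp <;> ring

end Pair

/-! ### Purification of two-qubit states -/

/-- Write `Q`, `R`, `S` for the `n`-th powers. For large `n`, `Q` is negligible against `R`. After
the Hadamard gates the unwanted ratio lies below `1` by order `R`, while the wanted one lies below
`1` by only order `Q`. Hence `m` of order `K / R` kills the former and hardly affects the latter. -/
theorem exists_pow_purification {q r s ε : ℝ} (hq : 0 ≤ q) (hqr : q < r) (hr : r ≤ 1)
    (hs : |s| ≤ q) (hε : 0 < ε) :
    ∃ n m : ℕ, n ≠ 0 ∧ m ≠ 0 ∧ 0 < 1 + q ^ n + r ^ n + s ^ n ∧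
      |((1 + q ^ n - r ^ n - s ^ n) / (1 + q ^ n + r ^ n + s ^ n)) ^ m| ≤ ε ∧
      |((1 - q ^ n + r ^ n - s ^ n) / (1 + q ^ n + r ^ n + s ^ n)) ^ m - 1| ≤ ε ∧
      |((1 - q ^ n - r ^ n + s ^ n) / (1 + q ^ n + r ^ n + s ^ n)) ^ m| ≤ ε := by
  have hr0 : 0 < r := hq.trans_lt hqr
  obtain ⟨K, hK0, hK⟩ : ∃ K : ℝ, 0 < K ∧ Real.exp (-(K / 4)) ≤ ε := by
    refine ⟨4 * |Real.log ε| + 4, by positivity, ?_⟩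
    rw [← Real.le_log_iff_exp_le hε]
    have := neg_abs_le (Real.log ε)
    linarith
  obtain ⟨n, hn⟩ := exists_pow_lt_of_lt_one (y := q / r)
    (show 0 < min (1 / 2) (ε / 4 / (K + 1)) by positivity) ((div_lt_one hr0).mpr hqr)
  obtain ⟨hn1, hn2⟩ := lt_min_iff.mp hn
  have hn0 : n ≠ 0 := by
    rintro rfl
    norm_num at hn1
  rw [div_pow] at hn1 hn2
  have hR0 : 0 < r ^ n := by positivity
  have hR1 : r ^ n ≤ 1 := pow_le_one₀ hr0.le hr
  have hQ0 : 0 ≤ q ^ n := by positivity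
  have hS : |s ^ n| ≤ q ^ n := by
    rw [abs_pow]
    gcongr
  refine ⟨n, ?_⟩
  generalize r ^ n = R at *
  generalize q ^ n = Q at *
  generalize s ^ n = S at *
  obtain ⟨hS1, hS2⟩ := abs_le.mp hS
  rw [div_lt_iff₀ hR0] at hn1
  have hm1 := Nat.le_ceil (K / R)
  have hm2 := (Nat.ceil_lt_add_one (show 0 ≤ K / R by positivity)).le
  refine ⟨⌈K / R⌉₊, hn0, (Nat.ceil_pos.mpr (by positivity)).ne', by linarith, ?_⟩
  generalize ⌈K / R⌉₊ = m at *
  have hα1 : 1 ≤ 1 + Q + R + S := by linarith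
  have hα4 : 1 + Q + R + S ≤ 4 := by linarith
  have hα0 : 0 < 1 + Q + R + S := by linarith
  rw [div_le_iff₀ hR0] at hm1
  have hb : ((1 + Q - R - S) / (1 + Q + R + S)) ^ m ≤ ε := by
    refine le_trans ?_ hK
    -- The deficit from `1` is `2(R + S) / (1 + Q + R + S)`, at least `R / 4` because `S ≥ -Q`, `Q <
    -- R / 2` and the denominator is at most `4`.
    have h1 : (1 + Q - R - S) / (1 + Q + R + S) ≤ Real.exp (-(R / 4)) := by
      refine le_trans ?_ (Real.one_sub_le_exp_neg _)
      rw [div_le_iff₀ hα0]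
      nlinarith
    calc _ ≤ Real.exp (-(R / 4)) ^ m :=
          pow_le_pow_left₀ (div_nonneg (by linarith) hα0.le) h1 m
      _ = Real.exp (-(m * R / 4)) := by
          rw [← Real.exp_nat_mul]
          congr 1
          ring
      _ ≤ _ := by
          gcongr
  refine ⟨?_, ?_, ?_⟩
  · rwa [abs_of_nonneg (pow_nonneg (div_nonneg (by linarith) hα0.le) m)]
  · have h0 : 0 ≤ (1 - Q + R - S) / (1 + Q + R + S) := div_nonneg (by linarith) hα0.le
    have h1 : ((1 - Q + R - S) / (1 + Q + R + S)) ≤ 1 := by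
      rw [div_le_one hα0]
      linarith
    have h2 : 1 + -(4 * Q) ≤ (1 - Q + R - S) / (1 + Q + R + S) := by
      rw [le_div_iff₀ hα0]
      nlinarith
    have hmQ : (m : ℝ) * (4 * Q) ≤ ε := by
      have h3 : (K / R + 1) * Q ≤ (K + 1) * (Q / R) := by
        have : Q ≤ Q / R := by
          rw [le_div_iff₀ hR0]
          nlinarith
        calc (K / R + 1) * Q = K * (Q / R) + Q := by ring
          _ ≤ K * (Q / R) + Q / R := by linarith
          _ = _ := by ring
      have h4 : (K + 1) * (Q / R) ≤ ε / 4 := by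
        rw [lt_div_iff₀ (by positivity)] at hn2
        linarith
      nlinarith
    have h5 : 1 - ε ≤ ((1 - Q + R - S) / (1 + Q + R + S)) ^ m := by
      -- Bernoulli's inequality needs a nonnegative base for the comparison of powers; otherwise `m
      -- ≥ 1` forces `ε > 1` and the bound is trivial.
      by_cases hQ2 : 4 * Q ≤ 1
      · have h6 := one_add_mul_le_pow (show (-2 : ℝ) ≤ -(4 * Q) by linarith) m
        have h7 := pow_le_pow_left₀ (by linarith) h2 m
        linarith
      · have h8 : (0 : ℝ) ≤ ((1 - Q + R - S) / (1 + Q + R + S)) ^ m := pow_nonneg h0 m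
        have h9 : (1 : ℝ) ≤ m := by
          have : (0 : ℝ) < m := by
            by_contra h
            nlinarith
          exact_mod_cast Nat.one_le_iff_ne_zero.mpr (by rintro rfl; simp at this)
        nlinarith
    rw [abs_le]
    constructor
    · linarith
    · have := pow_le_one₀ h0 h1 (n := m)
      linarith
  · refine le_trans ?_ hb
    rw [abs_pow, abs_div, abs_of_pos hα0]
    gcongr
    rw [abs_le]
    constructor <;> linarith

theorem xState_smul {W : Type*} (a b : W) (c α β γ δ : ℝ) :
    (c : ℂ) • xState a b α β γ δ = xState a b (c * α) (c * β) (c * γ) (c * δ) := by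
  ext z w
  simp only [xState, Matrix.smul_apply, smul_eq_mul, ← Complex.ofReal_mul]
  split_ifs <;> simp

/-- The exponent must be nonzero so that the vanishing entries stay zero, as `0 ^ 0 = 1`. -/
theorem xState_pow {W : Type*} (a b : W) (α β γ δ : ℝ) {n : ℕ} (hn : n ≠ 0) :
    (Matrix.of fun z w => xState a b α β γ δ z w ^ n) =
      xState a b (α ^ n) (β ^ n) (γ ^ n) (δ ^ n) := by
  ext z w
  simp only [xState, Matrix.of_apply, ← Complex.ofReal_pow]
  split_ifs <;> simp [hn]

theorem continuous_xState {W : Type*} (a b : W) :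
    Continuous fun q : ℝ × ℝ × ℝ => xState a b 1 q.1 q.2.1 q.2.2 := by
  refine continuous_matrix fun z w => ?_
  simp only [xState]
  refine Complex.continuous_ofReal.comp ?_
  split_ifs <;> fun_prop

theorem bell_mem_closure {W : Type*} [Fintype W] [DecidableEq W] {a b : W} (hab : a ≠ b)
    (hW : ∀ v, v = a ∨ v = b) {A B C : ℝ} (h₁ : 1 < A + B + C) (h₂ : 0 ≤ 1 + A - B - C)
    (h₃ : 0 ≤ 1 - A + B - C) (h₄ : 0 ≤ 1 - A - B + C) :
    pairState a b 1 1 1 ∈ closure {τ | SLOCCOutput (pairState a b A B C) τ} := by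
  have : Nonempty W := ⟨a⟩
  have hB : 0 < 1 + B := by linarith
  have hx : ((0, 1, 0) : ℝ × ℝ × ℝ) ∈ closure {q : ℝ × ℝ × ℝ |
      FilterOutput (pairState a b A B C) (xState a b 1 q.1 q.2.1 q.2.2)} := by
    rw [Metric.mem_closure_iff]
    intro ε hε
    obtain ⟨n, m, hn, hm, hα, hβ, hγ, hδ⟩ := exists_pow_purification
      (q := (1 - B) / (1 + B)) (r := (A + C) / (1 + B)) (s := (A - C) / (1 + B)) (ε := ε / 2)
      (div_nonneg (by linarith) hB.le) (by gcongr; linarith)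
      (by rw [div_le_one hB]; linarith)
      (by
        rw [abs_div, abs_of_pos hB]
        gcongr
        rw [abs_le]
        constructor <;> linarith) (by positivity)
    have t₁ := filterOutput_conj (pairState a b A B C) fun v => if v = b then hadMatrix else 1
    rw [hadamard_conj_pairState hab hW] at t₁
    have t₂ := t₁.trans (filterOutput_smul _ (c := 2 / (1 + B)) (by positivity))
    rw [xState_smul] at t₂
    have t₃ := t₂.trans (filterOutput_pow _ (n := n))
    rw [xState_pow _ _ _ _ _ _ hn] at t₃
    have t₄ := t₃.trans (filterOutput_conj _ fun _ => hadMatrix)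
    rw [hadamard_conj_xState hab hW] at t₄
    have e1 : 2 / (1 + B) * ((1 + B) / 2) = 1 := by field_simp
    have e2 : 2 / (1 + B) * ((1 - B) / 2) = (1 - B) / (1 + B) := by field_simp
    have e3 : 2 / (1 + B) * ((A + C) / 2) = (A + C) / (1 + B) := by field_simp
    have e4 : 2 / (1 + B) * ((A - C) / 2) = (A - C) / (1 + B) := by field_simp
    rw [e1, e2, e3, e4, one_pow] at t₄
    generalize ((1 - B) / (1 + B)) ^ n = Q at *
    generalize ((A + C) / (1 + B)) ^ n = R at *
    generalize ((A - C) / (1 + B)) ^ n = S at *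
    have t₅ := t₄.trans (filterOutput_smul _ (c := 1 / (2 * (1 + Q + R + S))) (by positivity))
    rw [xState_smul] at t₅
    have t₆ := t₅.trans (filterOutput_pow _ (n := m))
    rw [xState_pow _ _ _ _ _ _ hm] at t₆
    have f1 : 1 / (2 * (1 + Q + R + S)) * (2 * (1 + Q + R + S)) = 1 := by field_simp
    have f : ∀ t, 1 / (2 * (1 + Q + R + S)) * (2 * t) = t / (1 + Q + R + S) := by
      intro t
      field_simp
    rw [f1, one_pow, f, f, f] at t₆
    refine ⟨(_, _, _), t₆, ?_⟩
    rw [dist_comm]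
    simp only [Prod.dist_eq, Real.dist_eq, sub_zero]
    exact (max_le hβ (max_le hγ hδ)).trans_lt (by linarith)
  let H : QOp W := prodKraus fun v => if v = b then hadMatrix else 1
  let Φ : ℝ × ℝ × ℝ → QOp W := fun q =>
    ((1 / 4 : ℝ) : ℂ) • (H * xState a b 1 q.1 q.2.1 q.2.2 * Hᴴ)
  have hΦ : Continuous Φ :=
    ((continuous_const.matrix_mul (continuous_xState a b)).matrix_mul
      continuous_const).const_smul ((1 / 4 : ℝ) : ℂ)
  have hΦ0 : Φ (0, 1, 0) = pairState a b 1 1 1 := by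
    simp only [Φ, H]
    rw [hadamard_conj_xState_bell hab hW, smul_smul]
    norm_num
  rw [← hΦ0]
  refine map_mem_closure hΦ hx fun q hq => FilterOutput.sloccOutput ?_
  exact (FilterOutput.trans hq (filterOutput_conj _ _)).trans (filterOutput_smul _ (by norm_num))

/-! ### Labels glued from the ends of an edge and the other vertices -/

theorem glue_of_mem {V : Type*} [DecidableEq V] {e : Sym2 V} (z : {v // v ∈ e} → Fin 2)
    (s : {v // v ∉ e} → Fin 2) {v : V} (h : v ∈ e) : glue e z s v = z ⟨v, h⟩ := by
  simp [glue, h]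

theorem glue_of_notMem {V : Type*} [DecidableEq V] {e : Sym2 V} (z : {v // v ∈ e} → Fin 2)
    (s : {v // v ∉ e} → Fin 2) {v : V} (h : v ∉ e) : glue e z s v = s ⟨v, h⟩ := by
  simp [glue, h]

theorem edge_eq_of_mem {V : Type*} {e e' : Sym2 V} {x y : V} (hxy : x ≠ y) (h₁ : x ∈ e) (h₂ : y ∈ e)
    (h₃ : x ∈ e') (h₄ : y ∈ e') : e = e' :=
  ((Sym2.mem_and_mem_iff hxy).mp ⟨h₁, h₂⟩).trans ((Sym2.mem_and_mem_iff hxy).mp ⟨h₃, h₄⟩).symm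

section Graph

variable {V : Type*} [Fintype V] [DecidableEq V] (G : SimpleGraph V) [DecidableRel G.Adj]

/-! ### Signs of graph state amplitudes -/

/-- The sign of the amplitude of a basis label in the graph state. -/
def edgeSign (z : V → Fin 2) : ℂ :=
  ∏ e ∈ G.edgeFinset, if ∀ v ∈ e, z v = 1 then (-1 : ℂ) else 1

/-- The sign of the correction at the ends of `e` after the outcome `s` off `e`. -/
def corrSign (e : Sym2 V) (z : {v // v ∈ e} → Fin 2) (s : {v // v ∉ e} → Fin 2) : ℂ :=
  ∏ v : {v // v ∈ e}, ∏ c : {v // v ∉ e},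
    (if G.Adj v.1 c.1 ∧ z v = 1 ∧ s c = 1 then (-1 : ℂ) else 1)

theorem prod_sign_mul_self {ι : Type*} (s : Finset ι) (f : ι → ℂ) (h : ∀ i ∈ s, f i * f i = 1) :
    (∏ i ∈ s, f i) * ∏ i ∈ s, f i = 1 := by
  rw [← Finset.prod_mul_distrib]
  exact Finset.prod_eq_one h

theorem edgeSign_mul_self (z : V → Fin 2) : edgeSign G z * edgeSign G z = 1 :=
  prod_sign_mul_self _ _ fun e _ => by split_ifs <;> norm_num

theorem corrSign_mul_self (e : Sym2 V) (z : {v // v ∈ e} → Fin 2) (s : {v // v ∉ e} → Fin 2) :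
    corrSign G e z s * corrSign G e z s = 1 :=
  prod_sign_mul_self _ _ fun v _ => prod_sign_mul_self _ _ fun c _ => by split_ifs <;> norm_num

theorem star_edgeSign (z : V → Fin 2) : star (edgeSign G z) = edgeSign G z := by
  simp only [edgeSign, star_prod]
  exact Finset.prod_congr rfl fun e _ => by split_ifs <;> simp

theorem star_corrSign (e : Sym2 V) (z : {v // v ∈ e} → Fin 2) (s : {v // v ∉ e} → Fin 2) :
    star (corrSign G e z s) = corrSign G e z s := by
  simp only [corrSign, star_prod]
  exact Finset.prod_congr rfl fun v _ => Finset.prod_congr rfl fun c _ => by split_ifs <;> simp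

theorem edgeSign_eq_prod_phaseSign (z : V → Fin 2) :
    edgeSign G z = ∏ e : G.edgeSet, phaseSign fun v : {v // v ∈ e.1} => z v := by
  rw [edgeSign]
  rw [Finset.prod_subtype G.edgeFinset (p := fun e => e ∈ G.edgeSet)
    (fun e => SimpleGraph.mem_edgeFinset)]
  refine Finset.prod_congr rfl fun e _ => ?_
  simp [phaseSign]

theorem graphState_eq (z : V → Fin 2) :
    graphState G z = (1 / (Real.sqrt 2 : ℂ)) ^ Fintype.card V * edgeSign G z := rfl

theorem inv_sqrt_two_pow_mul_self (n : ℕ) :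
    (1 / (Real.sqrt 2 : ℂ)) ^ n * (1 / (Real.sqrt 2 : ℂ)) ^ n = (1 / 2) ^ n := by
  rw [← mul_pow]
  congr 1
  rw [div_mul_div_comm, ← Complex.ofReal_mul, Real.mul_self_sqrt (by norm_num)]
  norm_num

theorem star_graphState (z : V → Fin 2) : star (graphState G z) = graphState G z := by
  rw [graphState_eq, star_mul', star_edgeSign]
  simp

theorem graphState_mul (z w : V → Fin 2) :
    graphState G z * graphState G w =
      (1 / 2) ^ Fintype.card V * (edgeSign G z * edgeSign G w) := by
  rw [graphState_eq, graphState_eq, ← inv_sqrt_two_pow_mul_self]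
  ring

theorem star_graphState_dotProduct : star (graphState G) ⬝ᵥ graphState G = 1 := by
  simp only [dotProduct, Pi.star_apply, star_graphState, graphState_mul, edgeSign_mul_self]
  simp

/-- `glue` as a bijection. -/
def glueEquiv (e : Sym2 V) :
    (({v // v ∈ e} → Fin 2) × ({v // v ∉ e} → Fin 2)) ≃ (V → Fin 2) where
  toFun q := glue e q.1 q.2
  invFun x := (fun v => x v, fun v => x v)
  left_inv q := by
    refine Prod.ext (funext fun v => ?_) (funext fun v => ?_)
    · simp [glue, v.2]
    · simp [glue, v.2]
  right_inv x := by
    funext v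
    simp only [glue]
    split_ifs <;> rfl

theorem sum_eq_sum_glue (e : Sym2 V) (f : (V → Fin 2) → ℂ) :
    ∑ x, f x = ∑ z, ∑ s, f (glue e z s) := by
  rw [← Fintype.sum_prod_type']
  exact (Fintype.sum_equiv (glueEquiv e) _ _ fun _ => rfl).symm

theorem prod_incident_edges {e : Sym2 V} (z : {v // v ∈ e} → Fin 2)
    (s : {v // v ∉ e} → Fin 2) :
    ∏ e' ∈ (G.edgeFinset.erase e).filter (fun e' => ∃ v ∈ e', v ∈ e),
      (if ∀ v ∈ e', glue e z s v = 1 then (-1 : ℂ) else 1) = corrSign G e z s := by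
  rw [corrSign, ← Fintype.prod_prod_type']
  have h1 : ∀ q : {v // v ∈ e} × {v // v ∉ e},
      (if G.Adj q.1.1 q.2.1 ∧ z q.1 = 1 ∧ s q.2 = 1 then (-1 : ℂ) else 1) =
        if G.Adj q.1.1 q.2.1 then (if z q.1 = 1 ∧ s q.2 = 1 then (-1 : ℂ) else 1) else 1 := by
    intro q
    by_cases h : G.Adj q.1.1 q.2.1 <;> simp [h]
  simp only [h1]
  rw [← Finset.prod_filter (fun q : {v // v ∈ e} × {v // v ∉ e} => G.Adj q.1.1 q.2.1)]
  symm
  refine Finset.prod_bij (fun q _ => s(q.1.1, q.2.1)) ?_ ?_ ?_ ?_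
  · rintro ⟨⟨v, hv⟩, ⟨c, hc⟩⟩ h
    simp only [Finset.mem_filter, Finset.mem_univ, true_and] at h
    simp only [Finset.mem_filter, Finset.mem_erase, SimpleGraph.mem_edgeFinset,
      SimpleGraph.mem_edgeSet]
    refine ⟨⟨?_, h⟩, v, by simp, hv⟩
    rintro rfl
    exact hc (by simp)
  · rintro ⟨⟨v, hv⟩, ⟨c, hc⟩⟩ - ⟨⟨v', hv'⟩, ⟨c', hc'⟩⟩ - h
    simp only [Sym2.eq_iff] at h
    rcases h with ⟨rfl, rfl⟩ | ⟨rfl, rfl⟩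
    · rfl
    · exact absurd hv hc'
  · intro e' h
    simp only [Finset.mem_filter, Finset.mem_erase, SimpleGraph.mem_edgeFinset] at h
    obtain ⟨⟨hne, he'⟩, v, hv, hve⟩ := h
    obtain ⟨c, rfl⟩ := hv
    have hvc : v ≠ c := (SimpleGraph.mem_edgeSet G |>.mp he').ne
    have hc : c ∉ e := fun hc => hne (edge_eq_of_mem hvc (by simp) (by simp) hve hc)
    exact ⟨(⟨v, hve⟩, ⟨c, hc⟩), by simpa using he', rfl⟩
  · rintro ⟨⟨v, hv⟩, ⟨c, hc⟩⟩ -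
    simp [glue_of_mem z s hv, glue_of_notMem z s hc]

/-- Removing the ends of an edge from a graph state leaves its two-qubit graph state, up to the
correction and a global sign. -/
theorem edgeSign_glue {e : Sym2 V} (he : e ∈ G.edgeSet) (z : {v // v ∈ e} → Fin 2)
    (s : {v // v ∉ e} → Fin 2) :
    edgeSign G (glue e z s) = phaseSign z * corrSign G e z s * edgeSign G (glue e 0 s) := by
  have hz : ∀ z : {v // v ∈ e} → Fin 2, edgeSign G (glue e z s) = phaseSign z *
      (corrSign G e z s * ∏ e' ∈ (G.edgeFinset.erase e).filter (fun e' => ¬ ∃ v ∈ e', v ∈ e),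
        if ∀ v ∈ e', glue e z s v = 1 then (-1 : ℂ) else 1) := by
    intro z
    rw [edgeSign, ← Finset.mul_prod_erase _ _ (SimpleGraph.mem_edgeFinset.mpr he),
      ← prod_incident_edges, Finset.prod_filter_mul_prod_filter_not]
    congr 1
    have : (∀ v ∈ e, glue e z s v = 1) ↔ ∀ v : {v // v ∈ e}, z v = 1 := by
      refine ⟨fun h v => ?_, fun h v hv => ?_⟩
      · rw [← h v v.2, glue_of_mem]
      · rw [glue_of_mem z s hv]
        exact h _
    simp only [phaseSign, this]
  have h0 : phaseSign (0 : {v // v ∈ e} → Fin 2) = 1 := by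
    induction e with
    | _ a b =>
      rw [phaseSign, if_neg]
      intro h
      simpa using h ⟨a, by simp⟩
  have h1 : corrSign G e 0 s = 1 := by simp [corrSign]
  rw [hz z, hz 0, h0, h1, one_mul, one_mul, mul_assoc]
  congr 2
  refine Finset.prod_congr rfl fun e' he' => ?_
  have hd : ∀ v ∈ e', v ∉ e := by
    simp only [Finset.mem_filter, not_exists, not_and] at he'
    exact he'.2
  have : (∀ v ∈ e', glue e z s v = 1) ↔ ∀ v ∈ e', glue e 0 s v = 1 :=
    forall₂_congr fun v hv => by rw [glue_of_notMem z s (hd v hv), glue_of_notMem 0 s (hd v hv)]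
  simp only [this]

theorem measuredPair_apply (e : Sym2 V) (ρ : QOp V) (z w : {v // v ∈ e} → Fin 2) :
    measuredPair G e ρ z w = ∑ s, corrSign G e z s * ρ (glue e z s) (glue e w s) *
      corrSign G e w s := by
  have h : ∀ s z x, measureKraus G e s z x = if x = glue e z s then corrSign G e z s else 0 :=
    fun _ _ _ => rfl
  simp only [measuredPair, Matrix.sum_apply, Matrix.mul_apply, Matrix.conjTranspose_apply, h]
  refine Finset.sum_congr rfl fun s _ => ?_
  simp [star_corrSign, apply_ite]

/-! ### Rebuilding -/

theorem rebuild_apply (τ : (e : G.edgeSet) → QOp {v // v ∈ e.1}) (z w : V → Fin 2) :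
    rebuild G τ z w = ∏ e, τ e (fun v => z v) fun v => w v := by
  have h : ∀ z x, rebuildKraus G z x =
      if x = fun (e : G.edgeSet) (v : {v // v ∈ e.1}) => z v then 1 else 0 := by
    intro z x
    simp only [rebuildKraus, funext_iff]
  simp only [rebuild, Matrix.mul_apply, Matrix.conjTranspose_apply, h]
  simp [edgeTensor]

theorem rebuild_posSemidef {τ : (e : G.edgeSet) → QOp {v // v ∈ e.1}}
    (h : ∀ e, (τ e).PosSemidef) : (rebuild G τ).PosSemidef := by
  have := posSemidef_prod Finset.univ (fun e : G.edgeSet =>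
    (τ e).submatrix (fun (z : V → Fin 2) v => z v) fun z v => z v) fun e _ => (h e).submatrix _
  convert this using 1
  ext z w
  exact rebuild_apply G τ z w

theorem continuous_rebuild : Continuous (rebuild G) := by
  refine continuous_matrix fun z w => ?_
  simp only [rebuild_apply]
  refine continuous_finsetProd _ fun e _ => ?_
  exact (continuous_apply e).matrix_elem _ _

theorem rebuild_bell :
    rebuild G (fun _ => Matrix.of fun z w => phaseSign z * phaseSign w / 4) =
      (((1 / 4) ^ Fintype.card G.edgeSet * 2 ^ Fintype.card V : ℝ) : ℂ) • graphProj G := by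
  ext z w
  rw [rebuild_apply]
  simp only [graphProj, Matrix.smul_apply, Matrix.vecMulVec_apply, Pi.star_apply, star_graphState,
    graphState_mul, Matrix.of_apply, edgeSign_eq_prod_phaseSign, smul_eq_mul,
    Finset.prod_div_distrib, Finset.prod_mul_distrib, Finset.prod_const, Finset.card_univ]
  push_cast
  have : (2 : ℂ) ^ Fintype.card V * (1 / 2) ^ Fintype.card V = 1 := by
    rw [← mul_pow]
    norm_num
  rw [one_div_pow]
  linear_combination (-(∏ e : G.edgeSet, phaseSign fun v : {v // v ∈ e.1} => z v) *
    (∏ e : G.edgeSet, phaseSign fun v : {v // v ∈ e.1} => w v) * (1 / 4 ^ Fintype.card G.edgeSet)) *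
      this

theorem graphProj_trace : (graphProj G).trace = 1 := by
  rw [graphProj, Matrix.trace_vecMulVec, dotProduct_comm, star_graphState_dotProduct]

theorem graphProj_expectation :
    star (graphState G) ⬝ᵥ (graphProj G *ᵥ graphState G) = 1 := by
  rw [graphProj, Matrix.vecMulVec_mulVec]
  simp [star_graphState_dotProduct]

/-- If stochastic local operations on every measured pair come arbitrarily close to the two-qubit
graph state, then the graph state can be rebuilt with fidelity arbitrarily close to one. -/
theorem purifies_of_mem_closure {ρ : QOp V}
    (h : ∀ e : G.edgeSet, (Matrix.of fun z w => phaseSign z * phaseSign w / 4) ∈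
      closure {τ | SLOCCOutput (measuredPair G e.1 ρ) τ}) : Purifies G ρ := by
  intro ε hε
  let τ₀ : (e : G.edgeSet) → QOp {v // v ∈ e.1} := fun e =>
    Matrix.of fun z w => phaseSign z * phaseSign w / 4
  have hk : (0 : ℝ) < (1 / 4) ^ Fintype.card G.edgeSet * 2 ^ Fintype.card V := by positivity
  have htr : (rebuild G τ₀).trace.re = (1 / 4) ^ Fintype.card G.edgeSet * 2 ^ Fintype.card V := by
    rw [rebuild_bell, Matrix.trace_smul, graphProj_trace, smul_eq_mul, mul_one, Complex.ofReal_re]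
  have hF : fidelity (graphState G) (rebuild G τ₀) = 1 := by
    rw [fidelity, htr, rebuild_bell, Matrix.smul_mulVec, dotProduct_smul, graphProj_expectation,
      smul_eq_mul, mul_one, Complex.ofReal_re, div_self hk.ne']
  have hc : ContinuousAt (fun τ => fidelity (graphState G) (rebuild G τ)) τ₀ := by
    unfold fidelity
    refine ContinuousAt.div ?_ ?_ (by rw [htr]; exact hk.ne')
    · exact (Complex.continuous_re.comp (continuous_const.dotProduct
        ((continuous_rebuild G).matrix_mulVec continuous_const))).continuousAt
    · exact (Complex.continuous_re.comp (continuous_rebuild G).matrix_trace).continuousAt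
  have hU : {τ | 1 - ε < fidelity (graphState G) (rebuild G τ)} ∈ nhds τ₀ :=
    hc.eventually_const_lt (by simp only [hF]; linarith)
  have hcl : τ₀ ∈ closure (Set.univ.pi fun e : G.edgeSet =>
      {τ | SLOCCOutput (measuredPair G e.1 ρ) τ}) := by
    rw [closure_pi_set]
    exact fun e _ => h e
  obtain ⟨τ, h1, h2⟩ := mem_closure_iff_nhds.mp hcl _ hU
  exact ⟨τ, fun e => h2 e trivial, h1⟩

/-! ### Positive partial transposes obstruct purification -/

theorem sum_le_card_mul_blocks {Z S : Type*} [Fintype Z] [Fintype S] [DecidableEq S]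
    {R : Matrix (Z × S) (Z × S) ℂ} (hR : R.PosSemidef) :
    (∑ z, ∑ s, ∑ w, ∑ t, R (z, s) (w, t)).re ≤
      Fintype.card S * (∑ s, ∑ z, ∑ w, R (z, s) (w, s)).re := by
  let Q : S → S → ℂ := fun s t => ∑ z, ∑ w, R (z, s) (w, t)
  have h : ∀ s t, 0 ≤ (Q s s + Q t t - Q s t - Q t s).re := by
    intro s t
    have h1 := (Matrix.posSemidef_iff_dotProduct_mulVec.mp hR).2
      fun q => (if q.2 = s then 1 else 0) - if q.2 = t then 1 else 0
    have h2 : star (fun q : Z × S => ((if q.2 = s then 1 else 0) - if q.2 = t then 1 else 0 : ℂ)) ⬝ᵥ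
        (R *ᵥ fun q => (if q.2 = s then 1 else 0) - if q.2 = t then 1 else 0) =
        Q s s + Q t t - Q s t - Q t s := by
      simp only [dotProduct, Matrix.mulVec, Fintype.sum_prod_type, Pi.star_apply, star_sub,
        apply_ite (star : ℂ → ℂ), star_one, star_zero, mul_sub, sub_mul, mul_ite, ite_mul, mul_one,
        one_mul, mul_zero, zero_mul, Finset.sum_sub_distrib, Finset.sum_ite_eq', Finset.mem_univ,
        if_true, Q]
      ring
    rw [h2] at h1
    exact (Complex.le_def.mp h1).1
  have hsum : 0 ≤ ∑ s, ∑ t, (Q s s + Q t t - Q s t - Q t s).re :=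
    Finset.sum_nonneg fun s _ => Finset.sum_nonneg fun t _ => h s t
  have hswap : ∑ s, ∑ t, (Q t s).re = ∑ s, ∑ t, (Q s t).re := Finset.sum_comm
  simp only [Complex.add_re, Complex.sub_re, Finset.sum_add_distrib, Finset.sum_sub_distrib,
    Finset.sum_const, Finset.card_univ, nsmul_eq_mul, hswap] at hsum
  rw [← Finset.mul_sum] at hsum
  have e1 : (∑ z, ∑ s, ∑ w, ∑ t, R (z, s) (w, t)).re = ∑ s, ∑ t, (Q s t).re := by
    simp only [Q, ← Complex.re_sum]
    congr 1
    rw [Finset.sum_comm]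
    refine Finset.sum_congr rfl fun s _ => ?_
    rw [Finset.sum_comm (γ := S)]
    exact Finset.sum_congr rfl fun z _ => Finset.sum_comm
  have e2 : (∑ s, ∑ z, ∑ w, R (z, s) (w, s)).re = ∑ s, (Q s s).re := by
    simp only [Q, ← Complex.re_sum]
  rw [e1, e2]
  linarith

theorem partialTranspose_block_posSemidef {τ : (e : G.edgeSet) → QOp {v // v ∈ e.1}}
    (hτ : ∀ e, (τ e).PosSemidef) (e : G.edgeSet) (b : {v // v ∈ e.1})
    (hb : (partialTranspose b (τ e)).PosSemidef) (s : {v // v ∉ e.1} → Fin 2) :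
    (partialTranspose b (Matrix.of fun z w => corrSign G e.1 z s *
      rebuild G τ (glue e.1 z s) (glue e.1 w s) * corrSign G e.1 w s)).PosSemidef := by
  let N : G.edgeSet → QOp {v // v ∈ e.1} := fun e' z w =>
    τ e' (fun v => glue e.1 (Function.update z b (w b)) s v)
      fun v => glue e.1 (Function.update w b (z b)) s v
  have hN : ∀ e', (N e').PosSemidef := by
    intro e'
    by_cases hee : e' = e
    · subst hee
      have : N e' = partialTranspose b (τ e') := by
        ext z w
        simp only [N, partialTranspose]
        congr 1 <;> ext v <;> rw [glue_of_mem _ _ v.2]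
      rwa [this]
    by_cases hbe : b.1 ∈ e'.1
    · have hk : ∀ (z w : {v // v ∈ e.1} → Fin 2) (v : {v // v ∈ e'.1}),
          glue e.1 (Function.update z b (w b)) s v = glue e.1 w s v := by
        intro z w v
        by_cases hv : v.1 ∈ e.1
        · have : v.1 = b.1 := by
            by_contra hvb
            exact hee (Subtype.ext (edge_eq_of_mem hvb v.2 hbe hv b.2))
          have hvb : (⟨v.1, hv⟩ : {v // v ∈ e.1}) = b := Subtype.ext this
          rw [glue_of_mem _ _ hv, glue_of_mem _ _ hv, hvb, Function.update_self]
        · rw [glue_of_notMem _ _ hv, glue_of_notMem _ _ hv]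
      have : N e' = ((τ e').submatrix (fun (z : {v // v ∈ e.1} → Fin 2) v => glue e.1 z s v)
          fun z v => glue e.1 z s v)ᵀ := by
        ext z w
        simp only [N, hk, Matrix.transpose_apply, Matrix.submatrix_apply]
      rw [this]
      exact ((hτ e').submatrix _).transpose
    · have hk : ∀ (z w : {v // v ∈ e.1} → Fin 2) (v : {v // v ∈ e'.1}),
          glue e.1 (Function.update z b (w b)) s v = glue e.1 z s v := by
        intro z w v
        by_cases hv : v.1 ∈ e.1
        · have hvb : (⟨v.1, hv⟩ : {v // v ∈ e.1}) ≠ b := by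
            rintro rfl
            exact hbe v.2
          rw [glue_of_mem _ _ hv, glue_of_mem _ _ hv, Function.update_of_ne hvb]
        · rw [glue_of_notMem _ _ hv, glue_of_notMem _ _ hv]
      have : N e' = (τ e').submatrix (fun (z : {v // v ∈ e.1} → Fin 2) v => glue e.1 z s v)
          fun z v => glue e.1 z s v := by
        ext z w
        simp only [N, hk, Matrix.submatrix_apply]
      rw [this]
      exact (hτ e').submatrix _
  have hP := (posSemidef_prod Finset.univ N fun e' _ => hN e').mul_mul_conjTranspose_same
    (Matrix.diagonal fun z => corrSign G e.1 z s)
  convert hP using 1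
  ext z w
  have hc : corrSign G e.1 (Function.update z b (w b)) s *
      corrSign G e.1 (Function.update w b (z b)) s =
      corrSign G e.1 z s * corrSign G e.1 w s := by
    simp only [corrSign, ← Finset.prod_mul_distrib]
    refine Finset.prod_congr rfl fun v _ => Finset.prod_congr rfl fun c _ => ?_
    rcases eq_or_ne v b with rfl | hv
    · simp [mul_comm]
    · simp [hv]
  simp only [partialTranspose, Matrix.of_apply, Matrix.diagonal_conjTranspose,
    Matrix.mul_diagonal, Matrix.diagonal_mul, Pi.star_apply, star_corrSign, rebuild_apply, N]
  rw [mul_right_comm, hc]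
  ring

theorem card_notMem_add_two {a b : V} (hab : a ≠ b) :
    Fintype.card {v // v ∉ s(a, b)} + 2 = Fintype.card V := by
  have h1 : Fintype.card {v // v ∈ s(a, b)} = 2 := by
    rw [Fintype.card_subtype, show Finset.univ.filter (fun v => v ∈ s(a, b)) = {a, b} by
      ext v; simp, Finset.card_pair hab]
  have h2 := Fintype.card_subtype_compl (fun v => v ∈ s(a, b))
  have h3 := Fintype.card_subtype_le (fun v => v ∈ s(a, b))
  omega

theorem fidelity_rebuild_le_half {τ : (e : G.edgeSet) → QOp {v // v ∈ e.1}}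
    (hτ : ∀ e, (τ e).PosSemidef) {a b : V} (hab : G.Adj a b)
    (hb : (partialTranspose ⟨b, by simp⟩ (τ ⟨s(a, b), hab⟩)).PosSemidef) :
    fidelity (graphState G) (rebuild G τ) ≤ 1 / 2 := by
  let e : Sym2 V := s(a, b)
  let σ := rebuild G τ
  have hσ : σ.PosSemidef := rebuild_posSemidef G hτ
  have hW : ∀ v : {v // v ∈ e}, v = ⟨a, by simp [e]⟩ ∨ v = ⟨b, by simp [e]⟩ := by
    rintro ⟨v, hv⟩
    simpa [e] using hv
  have hne : (⟨a, by simp [e]⟩ : {v // v ∈ e}) ≠ ⟨b, by simp [e]⟩ := by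
    simpa using hab.ne
  have htr : σ.trace = ∑ s, ∑ z, σ (glue e z s) (glue e z s) := by
    rw [Matrix.trace, sum_eq_sum_glue e, Finset.sum_comm]
    rfl
  have hR : (Matrix.of fun q q' : ({v // v ∈ e} → Fin 2) × ({v // v ∉ e} → Fin 2) =>
      edgeSign G (glue e q.1 q.2) * σ (glue e q.1 q.2) (glue e q'.1 q'.2) *
        edgeSign G (glue e q'.1 q'.2)).PosSemidef := by
    have := (hσ.mul_mul_conjTranspose_same (Matrix.diagonal (edgeSign G))).submatrix
      fun q : ({v // v ∈ e} → Fin 2) × ({v // v ∉ e} → Fin 2) => glue e q.1 q.2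
    convert this using 1
    ext q q'
    simp [Matrix.diagonal_conjTranspose, Matrix.mul_diagonal, Matrix.diagonal_mul, star_edgeSign]
  have hnum : star (graphState G) ⬝ᵥ (σ *ᵥ graphState G) = ((1 / 2) ^ Fintype.card V : ℝ) *
      ∑ z, ∑ s, ∑ w, ∑ t, edgeSign G (glue e z s) * σ (glue e z s) (glue e w t) *
        edgeSign G (glue e w t) := by
    have h1 : ∀ x y, graphState G x * (σ x y * graphState G y) = ((1 / 2) ^ Fintype.card V : ℝ) *
        (edgeSign G x * σ x y * edgeSign G y) := by
      intro x y
      have := graphState_mul G x y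
      push_cast
      linear_combination σ x y * this
    simp only [dotProduct, Matrix.mulVec, Pi.star_apply, star_graphState, Finset.mul_sum, h1]
    simp only [sum_eq_sum_glue e]
  have hblock := sum_le_card_mul_blocks hR
  simp only [Matrix.of_apply] at hblock
  have hppt : ∀ s : {v // v ∉ e} → Fin 2, (∑ z, ∑ w, edgeSign G (glue e z s) *
      σ (glue e z s) (glue e w s) * edgeSign G (glue e w s)).re ≤
        2 * (∑ z, σ (glue e z s) (glue e z s)).re := by
    intro s
    have h1 := sum_phaseSign_le_trace hne hW
      (partialTranspose_block_posSemidef G hτ ⟨e, hab⟩ ⟨b, by simp [e]⟩ hb s)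
    have h2 : ∀ z w : {v // v ∈ e} → Fin 2, edgeSign G (glue e z s) *
      σ (glue e z s) (glue e w s) * edgeSign G (glue e w s) =
        phaseSign z * (corrSign G e z s * σ (glue e z s) (glue e w s) * corrSign G e w s) *
          phaseSign w := by
      intro z w
      rw [edgeSign_glue G (e := e) hab z, edgeSign_glue G (e := e) hab w]
      linear_combination (phaseSign z * corrSign G e z s * σ (glue e z s) (glue e w s) *
        corrSign G e w s * phaseSign w) * edgeSign_mul_self G (glue e 0 s)
    have h3 : (Matrix.of fun z w : {v // v ∈ e} → Fin 2 => corrSign G e z s *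
        σ (glue e z s) (glue e w s) * corrSign G e w s).trace =
          ∑ z, σ (glue e z s) (glue e z s) := by
      refine Finset.sum_congr rfl fun z _ => ?_
      simp only [Matrix.diag_apply, Matrix.of_apply]
      linear_combination σ (glue e z s) (glue e z s) * corrSign_mul_self G e z s
    simp only [h2]
    rw [← h3]
    exact h1
  have hsum : (∑ s, ∑ z, ∑ w, edgeSign G (glue e z s) *
      σ (glue e z s) (glue e w s) * edgeSign G (glue e w s)).re ≤ 2 * σ.trace.re := by
    rw [htr, Complex.re_sum, Complex.re_sum, Finset.mul_sum]
    exact Finset.sum_le_sum fun s _ => hppt s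
  have hcard : (Fintype.card ({v // v ∉ e} → Fin 2) : ℝ) * 4 = 2 ^ Fintype.card V := by
    rw [← card_notMem_add_two hab.ne]
    simp [e, pow_add]
    norm_num
  have htr0 : 0 ≤ σ.trace.re := (Complex.le_def.mp hσ.trace_nonneg).1
  rw [fidelity]
  refine div_le_of_le_mul₀ htr0 (by norm_num) ?_
  rw [hnum, Complex.re_ofReal_mul]
  have hpow : ((1 / 2) ^ Fintype.card V : ℝ) * 2 ^ Fintype.card V = 1 := by
    rw [← mul_pow]
    norm_num
  have hp : (0 : ℝ) < (1 / 2) ^ Fintype.card V := by positivity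
  calc _ ≤ ((1 / 2) ^ Fintype.card V : ℝ) *
        (Fintype.card ({v // v ∉ e} → Fin 2) * (2 * σ.trace.re)) := by
          refine mul_le_mul_of_nonneg_left (hblock.trans ?_) hp.le
          gcongr
    _ = 1 / 2 * σ.trace.re := by
          linear_combination ((1 / 2) ^ Fintype.card V * σ.trace.re / 2) * hcard +
            (σ.trace.re / 2) * hpow

theorem not_purifies_of_partialTranspose {ρ : QOp V}
    (hρ : ∀ e : G.edgeSet, (measuredPair G e.1 ρ).PosSemidef) {a b : V} (hab : G.Adj a b)
    (hb : (partialTranspose ⟨b, by simp⟩ (measuredPair G s(a, b) ρ)).PosSemidef) :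
    ¬ Purifies G ρ := by
  intro h
  obtain ⟨τ, hτ, hF⟩ := h (1 / 2) (by norm_num)
  have := fidelity_rebuild_le_half G (fun e => (hτ e).posSemidef (hρ e)) hab
    ((hτ ⟨s(a, b), hab⟩).partialTranspose_posSemidef _ hb)
  linarith

end Graph

/-! ### Local depolarizing noise in the computational basis -/

/-- The coefficient of `|i⟩⟨j|` in the image of `|k⟩⟨l|` under the depolarizing channel of one
qubit that shrinks the Bloch ball by the factor `x`. -/
noncomputable def depolKernel (x : ℝ) (i j k l : Fin 2) : ℂ :=
  (if i = k ∧ j = l then (x : ℂ) else 0) + if i = j ∧ k = l then (1 - x : ℂ) / 2 else 0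

theorem sum_errorProb_pauli (p : ℝ) (i j k l : Fin 2) :
    ∑ m : Fin 4, (errorProb p m : ℂ) * (pauli m i k * star (pauli m j l)) =
      depolKernel (1 - 4 * p / 3) i j k l := by
  rw [Fin.sum_univ_four]
  fin_cases i <;> fin_cases j <;> fin_cases k <;> fin_cases l <;>
    simp [errorProb, pauli, depolKernel] <;> ring

theorem depolKernel_eq_zero {x : ℝ} {i j k l : Fin 2} (h : ¬ (i = j ↔ k = l)) :
    depolKernel x i j k l = 0 := by
  rw [depolKernel, if_neg, if_neg, add_zero]
  · rintro ⟨h1, h2⟩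
    simp [h1, h2] at h
  · rintro ⟨rfl, rfl⟩
    simp at h

theorem depolKernel_self (x : ℝ) (i k l : Fin 2) :
    depolKernel x i i k l = if k = l then depolKernel x i i k k else 0 := by
  by_cases h : k = l
  · subst h
    simp
  · rw [if_neg h, depolKernel_eq_zero]
    simp [h]

theorem sum_depolKernel_sign (x : ℝ) {i j k l : Fin 2} (h : i = j ↔ k = l) :
    ∑ s : Fin 2, ∑ t : Fin 2, depolKernel x s s t t *
      (((if i = 1 ∧ s = 1 then -1 else 1) * (if j = 1 ∧ s = 1 then -1 else 1)) *
        ((if k = 1 ∧ t = 1 then -1 else 1) * (if l = 1 ∧ t = 1 then -1 else 1))) =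
      2 * if i = j then (1 : ℂ) else x := by
  revert h
  simp only [Fin.sum_univ_two, depolKernel]
  fin_cases i <;> fin_cases j <;> fin_cases k <;> fin_cases l <;> simp <;> ring

theorem sum_sum_prod {ι κ : Type*} [Fintype ι] [DecidableEq ι] [Fintype κ] (f : ι → κ → κ → ℂ) :
    ∑ s : ι → κ, ∑ t : ι → κ, ∏ c, f c (s c) (t c) = ∏ c, ∑ i, ∑ j, f c i j := by
  rw [Fintype.prod_sum]
  exact Finset.sum_congr rfl fun s _ => (Fintype.prod_sum _).symm

theorem localDepolarize_apply {V : Type*} [Fintype V] [DecidableEq V] (p : ℝ) (ρ : QOp V)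
    (z w : V → Fin 2) :
    localDepolarize p ρ z w = ∑ z', ∑ w',
      (∏ v, depolKernel (1 - 4 * p / 3) (z v) (w v) (z' v) (w' v)) * ρ z' w' := by
  simp only [← sum_errorProb_pauli, Fintype.prod_sum, Finset.sum_mul]
  simp only [localDepolarize, Matrix.sum_apply, Matrix.smul_apply, Matrix.mul_apply,
    Matrix.conjTranspose_apply, smul_eq_mul, Finset.sum_mul, Finset.mul_sum]
  rw [Finset.sum_comm]
  rw [Finset.sum_congr rfl fun _ _ => Finset.sum_comm]
  rw [Finset.sum_comm]
  refine Finset.sum_congr rfl fun z' _ => Finset.sum_congr rfl fun w' _ =>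
    Finset.sum_congr rfl fun s _ => ?_
  simp only [pauliString, Finset.prod_mul_distrib, star_prod, Complex.ofReal_prod]
  ring

theorem errorProb_nonneg {p : ℝ} (h₀ : 0 ≤ p) (h₁ : p ≤ 1) (k : Fin 4) : 0 ≤ errorProb p k := by
  fin_cases k <;> simp [errorProb] <;> linarith

theorem mem_pair_cases {V : Type*} {a b : V} (v : {v // v ∈ s(a, b)}) :
    v = ⟨a, by simp⟩ ∨ v = ⟨b, by simp⟩ := by
  obtain ⟨v, hv⟩ := v
  simpa using hv

/-- The contribution of the measured vertex `c` to the sign of the correction. -/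
def vertexSign {V : Type*} (G : SimpleGraph V) [DecidableRel G.Adj] (a b c : V)
    (i j k : Fin 2) : ℂ :=
  (if G.Adj a c ∧ i = 1 ∧ k = 1 then -1 else 1) * if G.Adj b c ∧ j = 1 ∧ k = 1 then -1 else 1

theorem sum_depolKernel_vertexSign {V : Type*} {G : SimpleGraph V} [DecidableRel G.Adj]
    {a b c : V} (hc : ¬ (G.Adj a c ∧ G.Adj b c)) (x : ℝ) {i j i' j' k l k' l' : Fin 2}
    (h : i = k ↔ i' = k') (h' : j = l ↔ j' = l') :
    ∑ s : Fin 2, ∑ t : Fin 2, depolKernel x s s t t *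
      ((vertexSign G a b c i j s * vertexSign G a b c k l s) *
        (vertexSign G a b c i' j' t * vertexSign G a b c k' l' t)) =
      2 * ((if i = k then 1 else if G.Adj a c then (x : ℂ) else 1) *
        if j = l then 1 else if G.Adj b c then (x : ℂ) else 1) := by
  by_cases ha : G.Adj a c
  · have hb : ¬ G.Adj b c := fun hb => hc ⟨ha, hb⟩
    simpa [vertexSign, ha, hb] using sum_depolKernel_sign x h
  · by_cases hb : G.Adj b c
    · simpa [vertexSign, ha, hb] using sum_depolKernel_sign x h'
    · have := sum_depolKernel_sign x (i := 0) (j := 0) (k := 0) (l := 0) (by simp)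
      simpa [vertexSign, ha, hb] using this

section Graph

variable {V : Type*} [Fintype V] [DecidableEq V] (G : SimpleGraph V) [DecidableRel G.Adj]

theorem measuredPair_posSemidef (e : Sym2 V) {ρ : QOp V} (hρ : ρ.PosSemidef) :
    (measuredPair G e ρ).PosSemidef :=
  Matrix.posSemidef_sum _ fun _ _ => hρ.mul_mul_conjTranspose_same _

theorem localDepolarize_graphProj_posSemidef {p : ℝ} (h₀ : 0 ≤ p) (h₁ : p ≤ 1) :
    (localDepolarize p (graphProj G)).PosSemidef := by
  refine Matrix.posSemidef_sum _ fun s _ => Matrix.PosSemidef.smul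
    ((Matrix.posSemidef_vecMulVec_self_star _).mul_mul_conjTranspose_same _) ?_
  exact_mod_cast Finset.prod_nonneg fun v _ => errorProb_nonneg h₀ h₁ (s v)

/-! ### Measured pairs -/

variable {G}

theorem corrSign_eq_prod_vertexSign {a b : V} (hab : a ≠ b) (z : {v // v ∈ s(a, b)} → Fin 2)
    (s : {v // v ∉ s(a, b)} → Fin 2) :
    corrSign G s(a, b) z s =
      ∏ c, vertexSign G a b c.1 (z ⟨a, by simp⟩) (z ⟨b, by simp⟩) (s c) := by
  rw [corrSign, prod_pair_univ (a := ⟨a, by simp⟩) (b := ⟨b, by simp⟩)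
    (by simpa using hab) mem_pair_cases, ← Finset.prod_mul_distrib]
  rfl

theorem mul_prod_adj_eq_pow_degree {a b : V} (hab : G.Adj a b) (x : ℂ) :
    x * ∏ c : {v // v ∉ s(a, b)}, (if G.Adj a c then x else 1) = x ^ G.degree a := by
  have h := Fintype.prod_subtype_mul_prod_subtype (fun v => v ∈ s(a, b))
    (fun v => if G.Adj a v then x else 1)
  rw [prod_pair_univ (a := ⟨a, by simp⟩) (b := ⟨b, by simp⟩)
    (by simpa using hab.ne) mem_pair_cases] at h
  simp only [SimpleGraph.irrefl, hab, if_true, if_false, one_mul] at h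
  rw [h, Finset.prod_ite, Finset.prod_const, Finset.prod_const_one, mul_one]
  congr 1
  rw [← SimpleGraph.card_neighborFinset_eq_degree, SimpleGraph.neighborFinset_eq_filter]

theorem sum_depolKernel_phaseSign {W : Type*} [Fintype W] [DecidableEq W] {a b : W} (hab : a ≠ b)
    (hW : ∀ v, v = a ∨ v = b) (x : ℝ) (z w : W → Fin 2) :
    ∑ z', ∑ w', (depolKernel x (z a) (w a) (z' a) (w' a) *
      depolKernel x (z b) (w b) (z' b) (w' b)) * (phaseSign z' * phaseSign w') =
      phaseSign z * phaseSign w * if z a = w a ∧ z b = w b then 1 else (x : ℂ) ^ 2 := by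
  simp only [sum_pair_univ hab hW, phaseSign_eq hW, if_true, if_neg hab.symm, Fin.sum_univ_two,
    depolKernel]
  generalize z a = i; generalize z b = j; generalize w a = k; generalize w b = l
  fin_cases i <;> fin_cases j <;> fin_cases k <;> fin_cases l <;> simp <;> ring

theorem two_pow_card_notMem {a b : V} (hab : a ≠ b) :
    (1 / 2 : ℂ) ^ Fintype.card V * 2 ^ Fintype.card {v // v ∉ s(a, b)} = 1 / 4 := by
  rw [← card_notMem_add_two hab, pow_add, mul_right_comm, ← mul_pow]
  norm_num

/-- The measured pair in terms of the noise on its two ends and on the measured vertices. -/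
theorem measuredPair_localDepolarize_apply {a b : V} (hab : G.Adj a b) (p : ℝ)
    (z w : {v // v ∈ s(a, b)} → Fin 2) :
    measuredPair G s(a, b) (localDepolarize p (graphProj G)) z w =
      (1 / 2) ^ Fintype.card V * ∑ z', ∑ w',
        ((∏ v, depolKernel (1 - 4 * p / 3) (z v) (w v) (z' v) (w' v)) *
          (phaseSign z' * phaseSign w')) *
        ∑ s : {v // v ∉ s(a, b)} → Fin 2, ∑ t : {v // v ∉ s(a, b)} → Fin 2,
          (∏ c, depolKernel (1 - 4 * p / 3) (s c) (s c) (t c) (t c)) *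
            ((corrSign G s(a, b) z s * corrSign G s(a, b) w s) *
              (corrSign G s(a, b) z' t * corrSign G s(a, b) w' t)) := by
  set x := 1 - 4 * p / 3 with hx
  rw [measuredPair_apply]
  simp only [localDepolarize_apply, ← hx]
  have hterm : ∀ (s t t' : {v // v ∉ s(a, b)} → Fin 2) (z' w' : {v // v ∈ s(a, b)} → Fin 2),
      (∏ v, depolKernel x (glue s(a, b) z s v) (glue s(a, b) w s v) (glue s(a, b) z' t v)
        (glue s(a, b) w' t' v)) * graphProj G (glue s(a, b) z' t) (glue s(a, b) w' t') =
      if t = t' then (1 / 2) ^ Fintype.card V *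
        (((∏ v, depolKernel x (z v) (w v) (z' v) (w' v)) * (phaseSign z' * phaseSign w')) *
        ((∏ c, depolKernel x (s c) (s c) (t c) (t c)) *
          (corrSign G s(a, b) z' t * corrSign G s(a, b) w' t))) else 0 := by
    intro s t t' z' w'
    rw [← Fintype.prod_subtype_mul_prod_subtype (fun v => v ∈ s(a, b))]
    have h1 : ∀ v : {v // v ∈ s(a, b)}, depolKernel x (glue s(a, b) z s v) (glue s(a, b) w s v)
        (glue s(a, b) z' t v) (glue s(a, b) w' t' v) =
        depolKernel x (z v) (w v) (z' v) (w' v) := by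
      intro v
      simp only [glue_of_mem _ _ v.2]
    have h2 : ∀ v : {v // v ∉ s(a, b)}, depolKernel x (glue s(a, b) z s v) (glue s(a, b) w s v)
        (glue s(a, b) z' t v) (glue s(a, b) w' t' v) =
        if t v = t' v then depolKernel x (s v) (s v) (t v) (t v) else 0 := by
      intro v
      simp only [glue_of_notMem _ _ v.2]
      rw [depolKernel_self]
    simp only [h1, h2]
    rw [Finset.prod_ite_zero]
    by_cases ht : t = t'
    · subst ht
      simp only [implies_true, if_true, graphProj, Matrix.vecMulVec_apply, Pi.star_apply,
        star_graphState, graphState_mul]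
      rw [edgeSign_glue G hab z', edgeSign_glue G hab w']
      linear_combination ((1 / 2) ^ Fintype.card V *
        (∏ v, depolKernel x (z v) (w v) (z' v) (w' v)) * (phaseSign z' * phaseSign w') *
        ((∏ c, depolKernel x (s c) (s c) (t c) (t c)) *
          (corrSign G s(a, b) z' t * corrSign G s(a, b) w' t))) *
            edgeSign_mul_self G (glue s(a, b) 0 t)
    · have ht' : ¬ ∀ i ∈ (Finset.univ : Finset {v // v ∉ s(a, b)}), t i = t' i := fun h =>
        ht (funext fun i => h i (Finset.mem_univ i))
      rw [if_neg ht, if_neg ht', mul_zero, zero_mul]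
  simp only [sum_eq_sum_glue s(a, b), hterm, Finset.sum_ite_eq, Finset.mem_univ, if_true,
    Finset.mul_sum, Finset.sum_mul]
  rw [Finset.sum_comm]
  refine Finset.sum_congr rfl fun z' _ => ?_
  rw [Finset.sum_congr rfl fun _ _ => Finset.sum_comm, Finset.sum_comm]
  refine Finset.sum_congr rfl fun w' _ => Finset.sum_congr rfl fun s _ =>
    Finset.sum_congr rfl fun t _ => ?_
  ring

/-- The sum over the outcomes `s` and the labels `t` of the measured vertices before the noise. -/
theorem sum_corrSign {a b : V} (hab : a ≠ b) (hc : ∀ c, ¬ (G.Adj a c ∧ G.Adj b c)) (x : ℝ)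
    {z w z' w' : {v // v ∈ s(a, b)} → Fin 2}
    (h : z ⟨a, by simp⟩ = w ⟨a, by simp⟩ ↔ z' ⟨a, by simp⟩ = w' ⟨a, by simp⟩)
    (h' : z ⟨b, by simp⟩ = w ⟨b, by simp⟩ ↔ z' ⟨b, by simp⟩ = w' ⟨b, by simp⟩) :
    ∑ s : {v // v ∉ s(a, b)} → Fin 2, ∑ t : {v // v ∉ s(a, b)} → Fin 2,
        (∏ c, depolKernel x (s c) (s c) (t c) (t c)) *
          ((corrSign G s(a, b) z s * corrSign G s(a, b) w s) *
            (corrSign G s(a, b) z' t * corrSign G s(a, b) w' t)) =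
      ∏ c : {v // v ∉ s(a, b)}, (2 * ((if z ⟨a, by simp⟩ = w ⟨a, by simp⟩ then 1
        else if G.Adj a c then (x : ℂ) else 1) *
          if z ⟨b, by simp⟩ = w ⟨b, by simp⟩ then 1 else if G.Adj b c then (x : ℂ) else 1)) := by
  simp only [corrSign_eq_prod_vertexSign hab]
  generalize z ⟨a, by simp⟩ = i at *
  generalize z ⟨b, by simp⟩ = j at *
  generalize w ⟨a, by simp⟩ = k at *
  generalize w ⟨b, by simp⟩ = l at *
  generalize z' ⟨a, by simp⟩ = i' at *
  generalize z' ⟨b, by simp⟩ = j' at *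
  generalize w' ⟨a, by simp⟩ = k' at *
  generalize w' ⟨b, by simp⟩ = l' at *
  rw [Finset.prod_congr rfl fun c _ => (sum_depolKernel_vertexSign (hc c.1) x h h').symm,
    ← sum_sum_prod]
  simp only [Finset.prod_mul_distrib]

theorem measuredPair_localDepolarize {a b : V} (hab : G.Adj a b)
    (hc : ∀ c, ¬ (G.Adj a c ∧ G.Adj b c)) (p : ℝ) :
    measuredPair G s(a, b) (localDepolarize p (graphProj G)) =
      pairState ⟨a, by simp⟩ ⟨b, by simp⟩ ((1 - 4 * p / 3) ^ (G.degree a + 1))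
        ((1 - 4 * p / 3) ^ (G.degree b + 1)) ((1 - 4 * p / 3) ^ (G.degree a + G.degree b)) := by
  ext z w
  rw [measuredPair_localDepolarize_apply hab]
  set x := 1 - 4 * p / 3 with hx
  let a' : {v // v ∈ s(a, b)} := ⟨a, by simp⟩
  let b' : {v // v ∈ s(a, b)} := ⟨b, by simp⟩
  have hne : a' ≠ b' := by simpa [a', b'] using hab.ne
  have hW : ∀ v, v = a' ∨ v = b' := mem_pair_cases
  let Da : ℂ := ∏ c : {v // v ∉ s(a, b)}, (if G.Adj a c then (x : ℂ) else 1)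
  let Db : ℂ := ∏ c : {v // v ∉ s(a, b)}, (if G.Adj b c then (x : ℂ) else 1)
  have hDa : (x : ℂ) * Da = (x : ℂ) ^ G.degree a := mul_prod_adj_eq_pow_degree hab _
  have hDb : (x : ℂ) * Db = (x : ℂ) ^ G.degree b := by
    rw [← mul_prod_adj_eq_pow_degree hab.symm]
    congr 1
    simp only [Db]
    rw [Sym2.eq_swap]
  have hsum : ∀ z' w' : {v // v ∈ s(a, b)} → Fin 2, (z a' = w a' ↔ z' a' = w' a') →
      (z b' = w b' ↔ z' b' = w' b') →
      ∑ s : {v // v ∉ s(a, b)} → Fin 2, ∑ t : {v // v ∉ s(a, b)} → Fin 2,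
          (∏ c, depolKernel x (s c) (s c) (t c) (t c)) *
            ((corrSign G s(a, b) z s * corrSign G s(a, b) w s) *
              (corrSign G s(a, b) z' t * corrSign G s(a, b) w' t)) =
        2 ^ Fintype.card {v // v ∉ s(a, b)} *
          ((if z a' = w a' then 1 else Da) * if z b' = w b' then 1 else Db) := by
    intro z' w' h h'
    rw [sum_corrSign hab.ne hc x h h', Finset.prod_mul_distrib, Finset.prod_mul_distrib,
      Finset.prod_const, Finset.card_univ]
    congr 2 <;> split_ifs <;> simp [Da, Db]
  have hall : ∀ z' w' : {v // v ∈ s(a, b)} → Fin 2,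
      ((∏ v, depolKernel x (z v) (w v) (z' v) (w' v)) * (phaseSign z' * phaseSign w')) *
        ∑ s : {v // v ∉ s(a, b)} → Fin 2, ∑ t : {v // v ∉ s(a, b)} → Fin 2,
          (∏ c, depolKernel x (s c) (s c) (t c) (t c)) *
            ((corrSign G s(a, b) z s * corrSign G s(a, b) w s) *
              (corrSign G s(a, b) z' t * corrSign G s(a, b) w' t)) =
      ((depolKernel x (z a') (w a') (z' a') (w' a') *
        depolKernel x (z b') (w b') (z' b') (w' b')) * (phaseSign z' * phaseSign w')) *
      (2 ^ Fintype.card {v // v ∉ s(a, b)} *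
          ((if z a' = w a' then 1 else Da) * if z b' = w b' then 1 else Db)) := by
    intro z' w'
    rw [prod_pair_univ hne hW]
    by_cases h : z a' = w a' ↔ z' a' = w' a'
    · by_cases h' : z b' = w b' ↔ z' b' = w' b'
      · rw [hsum z' w' h h']
      · simp only [depolKernel_eq_zero h', mul_zero, zero_mul]
    · simp only [depolKernel_eq_zero h, zero_mul]
  simp only [hall, ← Finset.sum_mul]
  rw [sum_depolKernel_phaseSign hne hW, pairState]
  change _ = phaseSign z * phaseSign w * (((if z a' = w a' then if z b' = w b' then 1
    else x ^ (G.degree b + 1) else if z b' = w b' then x ^ (G.degree a + 1)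
      else x ^ (G.degree a + G.degree b) : ℝ)) : ℂ) / 4
  have h4 := two_pow_card_notMem hab.ne
  by_cases h : z a' = w a' <;> by_cases h' : z b' = w b' <;> simp only [h, h', if_true, if_false,
    and_true, and_false] <;> push_cast
  · linear_combination (phaseSign z * phaseSign w) * h4
  · rw [pow_succ _ (G.degree b), ← hDb]
    linear_combination (phaseSign z * phaseSign w * x ^ 2 * Db) * h4
  · rw [pow_succ _ (G.degree a), ← hDa]
    linear_combination (phaseSign z * phaseSign w * x ^ 2 * Da) * h4
  · rw [pow_add, ← hDa, ← hDb]
    linear_combination (phaseSign z * phaseSign w * x ^ 2 * Da * Db) * h4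

theorem measuredPair_maxDepolarized {a b : V} (hab : G.Adj a b) {x : ℝ} (hx : -1 ≤ x) :
    measuredPair G s(a, b) (maxDepolarized G x) =
      pairState ⟨a, by simp⟩ ⟨b, by simp⟩ (x / (2 ^ Fintype.card V + x))
        (x / (2 ^ Fintype.card V + x)) (x / (2 ^ Fintype.card V + x)) := by
  have hN : (0 : ℝ) < 2 ^ Fintype.card V + x := by
    have : (1 : ℝ) < 2 ^ Fintype.card V :=
      one_lt_pow₀ (by norm_num) (Fintype.card_pos_iff.mpr ⟨a⟩).ne'
    linarith
  have hN' : (2 : ℂ) ^ Fintype.card V + x ≠ 0 := by exact_mod_cast hN.ne'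
  have hcard : (Fintype.card ({v // v ∉ s(a, b)} → Fin 2) : ℂ) =
      2 ^ Fintype.card {v // v ∉ s(a, b)} := by simp
  have h4 := two_pow_card_notMem hab.ne
  have h2 : (2 : ℂ) ^ Fintype.card V * (1 / 2) ^ Fintype.card V = 1 := by
    rw [← mul_pow]
    norm_num
  ext z w
  have hone : ∀ s, (1 : QOp V) (glue s(a, b) z s) (glue s(a, b) w s) =
      if z = w then 1 else 0 := by
    intro s
    rw [Matrix.one_apply]
    congr 1
    refine propext ⟨fun h => funext fun v => ?_, fun h => by rw [h]⟩
    have := congrFun h v.1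
    rwa [glue_of_mem _ _ v.2, glue_of_mem _ _ v.2] at this
  have hterm : ∀ s, corrSign G s(a, b) z s * maxDepolarized G x (glue s(a, b) z s)
      (glue s(a, b) w s) * corrSign G s(a, b) w s =
      1 / (2 ^ Fintype.card V + x) * ((if z = w then 1 else 0) +
        x * ((1 / 2) ^ Fintype.card V * (phaseSign z * phaseSign w))) := by
    intro s
    simp only [maxDepolarized, Matrix.smul_apply, Matrix.add_apply, hone, graphProj,
      Matrix.vecMulVec_apply, Pi.star_apply, star_graphState, graphState_mul, smul_eq_mul]
    rw [edgeSign_glue G hab z, edgeSign_glue G hab w]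
    have e1 := corrSign_mul_self G s(a, b) z s
    have e2 := corrSign_mul_self G s(a, b) w s
    have e3 := edgeSign_mul_self G (glue s(a, b) 0 s)
    have e4 : corrSign G s(a, b) z s * corrSign G s(a, b) w s * (if z = w then 1 else 0) =
        if z = w then 1 else 0 := by
      split_ifs with h
      · rw [← h, e1, mul_one]
      · simp
    generalize corrSign G s(a, b) z s = c at *
    generalize corrSign G s(a, b) w s = d at *
    generalize edgeSign G (glue s(a, b) 0 s) = θ at *
    generalize (if z = w then 1 else 0 : ℂ) = δ at *
    generalize (1 / (2 ^ Fintype.card V + x) : ℂ) = k at *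
    generalize ((1 / 2) ^ Fintype.card V : ℂ) = y at *
    linear_combination k * e4 + k * x * y * phaseSign z * phaseSign w *
      (d * d * θ * θ * e1 + θ * θ * e2 + e3)
  rw [measuredPair_apply, Finset.sum_congr rfl fun s _ => hterm s, Finset.sum_const,
    Finset.card_univ, nsmul_eq_mul, hcard, pairState]
  have hiff := eq_iff_pair (mem_pair_cases (a := a) (b := b)) (z := z) (w := w)
  have hcase : (((if z ⟨a, by simp⟩ = w ⟨a, by simp⟩ then if z ⟨b, by simp⟩ = w ⟨b, by simp⟩ then 1
      else x / (2 ^ Fintype.card V + x) else if z ⟨b, by simp⟩ = w ⟨b, by simp⟩ then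
        x / (2 ^ Fintype.card V + x) else x / (2 ^ Fintype.card V + x) : ℝ)) : ℂ) =
      if z = w then 1 else (x : ℂ) / (2 ^ Fintype.card V + x) := by
    simp only [hiff]
    split_ifs <;> first | (push_cast; rfl) | simp_all
  rw [hcase]
  by_cases h : z = w
  · subst h
    have hp : phaseSign z * phaseSign z = 1 := by
      unfold phaseSign
      split_ifs <;> norm_num
    simp only [if_true, hp]
    field_simp
    linear_combination (4 * 2 ^ Fintype.card V + 4 * x) * h4 -
      4 * 2 ^ Fintype.card {v // v ∉ s(a, b)} * h2
  · simp only [h, if_false]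
    field_simp
    linear_combination (4 * x * phaseSign z * phaseSign w) * h4

end Graph

/-! ### The critical error rate -/

theorem criticalPoly_strictMono (D : ℕ) {x y : ℝ} (hx : 0 ≤ x) (hxy : x < y) :
    x ^ (2 * D) + 2 * x ^ (D + 1) - 1 < y ^ (2 * D) + 2 * y ^ (D + 1) - 1 := by
  have h1 : x ^ (2 * D) ≤ y ^ (2 * D) := pow_le_pow_left₀ hx hxy.le _
  have h2 : x ^ (D + 1) < y ^ (D + 1) := pow_lt_pow_left₀ hxy hx (by omega)
  linarith

theorem existsUnique_isCriticalRate (D : ℕ) : ∃! pc : ℝ, IsCriticalRate D pc := by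
  have hcont : ContinuousOn (fun x : ℝ => x ^ (2 * D) + 2 * x ^ (D + 1) - 1) (Set.Icc 0 1) := by
    fun_prop
  have h0 : (0 : ℝ) ^ (2 * D) ≤ 1 := pow_le_one₀ le_rfl zero_le_one
  obtain ⟨x, ⟨hx0, hx1⟩, hx⟩ := intermediate_value_Icc (zero_le_one' ℝ) hcont
    (show (0 : ℝ) ∈ _ from ⟨by simpa using h0, by norm_num⟩)
  have hxe : 1 - 4 * (3 / 4 * (1 - x)) / 3 = x := by ring
  refine ⟨3 / 4 * (1 - x), ⟨⟨by linarith, by linarith⟩, ?_⟩, ?_⟩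
  · rw [hxe]
    exact hx
  · rintro p ⟨⟨hp0, hp1⟩, hp⟩
    rcases lt_trichotomy x (1 - 4 * p / 3) with h | h | h
    · have := criticalPoly_strictMono D hx0 h
      simp only at hx
      linarith
    · linarith
    · have := criticalPoly_strictMono D (by linarith) h
      simp only at hx
      linarith

theorem criticalRate_three_near {pc : ℝ} (h : IsCriticalRate 3 pc) : |pc - 0.16| < 0.0005 := by
  obtain ⟨⟨h0, h1⟩, h⟩ := h
  rw [abs_lt]
  constructor
  · by_contra hc
    have hlt : (0.7865 : ℝ) < 1 - 4 * pc / 3 := by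
      norm_num at hc ⊢
      linarith
    have := criticalPoly_strictMono 3 (by norm_num) hlt
    rw [h] at this
    norm_num at this
  · by_contra hc
    have hle : 1 - 4 * pc / 3 ≤ (0.786 : ℝ) := by
      norm_num at hc ⊢
      linarith
    rcases hle.eq_or_lt with heq | hlt
    · rw [heq] at h
      norm_num at h
    · have := criticalPoly_strictMono 3 (by linarith) hlt
      rw [h] at this
      norm_num at this

/-! ### Purification thresholds -/

theorem not_adj_adj_of_colorable {V : Type*} {G : SimpleGraph V} (hG : G.Colorable 2) {a b : V}
    (hab : G.Adj a b) (c : V) :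
    ¬ (G.Adj a c ∧ G.Adj b c) := by
  rintro ⟨hac, hbc⟩
  obtain ⟨f⟩ := hG
  have h1 := f.valid hab
  have h2 := f.valid hac
  have h3 := f.valid hbc
  generalize f a = i at *
  generalize f b = j at *
  generalize f c = k at *
  omega

section Graph

variable {V : Type*} [Fintype V] [DecidableEq V] {G : SimpleGraph V} [DecidableRel G.Adj]

theorem purifies_of_measuredPair {ρ : QOp V}
    (h : ∀ a b, G.Adj a b → ∃ A B C : ℝ,
      measuredPair G s(a, b) ρ = pairState ⟨a, by simp⟩ ⟨b, by simp⟩ A B C ∧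
      1 < A + B + C ∧ 0 ≤ 1 + A - B - C ∧ 0 ≤ 1 - A + B - C ∧ 0 ≤ 1 - A - B + C) :
    Purifies G ρ := by
  refine purifies_of_mem_closure G ?_
  rintro ⟨e, he⟩
  induction e with
  | _ a b =>
    have hab : G.Adj a b := he
    obtain ⟨A, B, C, hρ, h₁, h₂, h₃, h₄⟩ := h a b hab
    have := bell_mem_closure (a := (⟨a, by simp⟩ : {v // v ∈ s(a, b)})) (b := ⟨b, by simp⟩)
      (by simpa using hab.ne) mem_pair_cases h₁ h₂ h₃ h₄
    simp only [hρ]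
    convert this using 1
    ext z w
    simp [pairState]

theorem purifies_localDepolarize (hG : G.Colorable 2) {D : ℕ} (hD : ∀ v, G.degree v ≤ D) {pc p : ℝ}
    (hpc : IsCriticalRate D pc) (h₀ : 0 ≤ p) (hp : p < pc) :
    Purifies G (localDepolarize p (graphProj G)) := by
  obtain ⟨⟨hpc0, hpc1⟩, hpc⟩ := hpc
  refine purifies_of_measuredPair fun a b hab => ⟨_, _, _,
    measuredPair_localDepolarize hab (not_adj_adj_of_colorable hG hab) p, ?_⟩
  have hpoly := criticalPoly_strictMono D (show 0 ≤ 1 - 4 * pc / 3 by linarith)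
    (show 1 - 4 * pc / 3 < 1 - 4 * p / 3 by linarith)
  rw [hpc] at hpoly
  have hx0 : 0 ≤ 1 - 4 * p / 3 := by linarith
  have hx1 : 1 - 4 * p / 3 ≤ 1 := by linarith
  generalize 1 - 4 * p / 3 = x at *
  obtain ⟨m, hm⟩ : ∃ m, G.degree a = m + 1 :=
    Nat.exists_eq_succ_of_ne_zero ((G.degree_pos_iff_exists_adj a).mpr ⟨b, hab⟩).ne'
  obtain ⟨n, hn⟩ : ∃ n, G.degree b = n + 1 :=
    Nat.exists_eq_succ_of_ne_zero ((G.degree_pos_iff_exists_adj b).mpr ⟨a, hab.symm⟩).ne'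
  have hA : x ^ (D + 1) ≤ x ^ (G.degree a + 1) :=
    pow_le_pow_of_le_one hx0 hx1 (by linarith [hD a])
  have hB : x ^ (D + 1) ≤ x ^ (G.degree b + 1) :=
    pow_le_pow_of_le_one hx0 hx1 (by linarith [hD b])
  have hC : x ^ (2 * D) ≤ x ^ (G.degree a + G.degree b) :=
    pow_le_pow_of_le_one hx0 hx1 (by linarith [hD a, hD b])
  refine ⟨by linarith, ?_⟩
  rw [hm, hn]
  have e1 : x ^ (m + 1 + 1) = x ^ 2 * x ^ m := by ring
  have e2 : x ^ (n + 1 + 1) = x ^ 2 * x ^ n := by ring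
  have e3 : x ^ (m + 1 + (n + 1)) = x ^ 2 * (x ^ m * x ^ n) := by ring
  rw [e1, e2, e3]
  have u0 : 0 ≤ x ^ m := by positivity
  have v0 : 0 ≤ x ^ n := by positivity
  have u1 : x ^ m ≤ 1 := pow_le_one₀ hx0 hx1
  have v1 : x ^ n ≤ 1 := pow_le_one₀ hx0 hx1
  have y0 : 0 ≤ x ^ 2 := by positivity
  have y1 : x ^ 2 ≤ 1 := pow_le_one₀ hx0 hx1
  generalize x ^ m = u at *
  generalize x ^ n = v at *
  generalize x ^ 2 = y at *
  refine ⟨?_, ?_, ?_⟩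
  · have h1 : y * v ≤ 1 := mul_le_one₀ y1 v0 v1
    have h2 : 0 ≤ y * (u * (1 - v)) := mul_nonneg y0 (mul_nonneg u0 (by linarith))
    linarith
  · have h1 : y * u ≤ 1 := mul_le_one₀ y1 u0 u1
    have h2 : 0 ≤ y * (v * (1 - u)) := mul_nonneg y0 (mul_nonneg v0 (by linarith))
    linarith
  · have h2 : 0 ≤ y * ((1 - u) * (1 - v)) :=
      mul_nonneg y0 (mul_nonneg (by linarith) (by linarith))
    linarith

theorem not_purifies_localDepolarize (hG : G.Colorable 2) {D : ℕ} {pc p : ℝ}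
    (hpc : IsCriticalRate D pc) {a b : V} (hab : G.Adj a b) (ha : G.degree a = D)
    (hb : G.degree b = D) (hp : pc ≤ p) (h₁ : p ≤ 1) :
    ¬ Purifies G (localDepolarize p (graphProj G)) := by
  obtain ⟨⟨hpc0, hpc1⟩, hpc⟩ := hpc
  refine not_purifies_of_partialTranspose G (fun e => measuredPair_posSemidef G e.1
    (localDepolarize_graphProj_posSemidef G (by linarith) h₁)) hab ?_
  rw [measuredPair_localDepolarize hab (not_adj_adj_of_colorable hG hab) p,
    partialTranspose_pairState (by simpa using hab.ne) mem_pair_cases, ha, hb, ← two_mul]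
  have hD : 1 ≤ D := ha ▸ (G.degree_pos_iff_exists_adj a).mpr ⟨b, hab⟩
  have hx0 : -(1 / 3) ≤ 1 - 4 * p / 3 := by linarith
  have hxc : 1 - 4 * p / 3 ≤ 1 - 4 * pc / 3 := by linarith
  have hc1 : 1 - 4 * pc / 3 ≤ 1 := by linarith
  generalize 1 - 4 * pc / 3 = y at *
  generalize 1 - 4 * p / 3 = x at *
  have hC0 : 0 ≤ x ^ (2 * D) := by
    rw [pow_mul]
    positivity
  suffices h : 0 ≤ 1 + 2 * x ^ (D + 1) - x ^ (2 * D) ∧ x ^ (2 * D) + 2 * x ^ (D + 1) - 1 ≤ 0 from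
    pairState_posSemidef mem_pair_cases (by linarith [h.1]) (by linarith) (by linarith)
      (by linarith [h.2])
  rcases le_or_gt 0 x with hx | hx
  · refine ⟨?_, ?_⟩
    · have h1 : x ^ (2 * D) ≤ 1 := pow_le_one₀ hx (hxc.trans hc1)
      have h2 : 0 ≤ x ^ (D + 1) := by positivity
      linarith
    · rcases hxc.eq_or_lt with rfl | hlt
      · exact hpc.le
      · exact ((criticalPoly_strictMono D hx hlt).trans_le hpc.le).le
  · have habs : |x| ≤ 1 / 3 := abs_le.mpr ⟨by linarith, by linarith⟩
    have hpow : ∀ n, 2 ≤ n → |x ^ n| ≤ 1 / 9 := by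
      intro n hn
      rw [abs_pow]
      calc |x| ^ n ≤ |x| ^ 2 := pow_le_pow_of_le_one (abs_nonneg x) (by linarith) hn
        _ ≤ (1 / 3) ^ 2 := by gcongr
        _ = 1 / 9 := by norm_num
    have h1 := abs_le.mp (hpow (D + 1) (by omega))
    have h2 := abs_le.mp (hpow (2 * D) (by omega))
    exact ⟨by linarith [h1.1, h2.2], by linarith [h1.2, h2.2]⟩

theorem fidelity_maxDepolarized (G : SimpleGraph V) [DecidableRel G.Adj] (x : ℝ) :
    fidelity (graphState G) (maxDepolarized G x) =
      ((1 + x) / (2 ^ Fintype.card V + x)) / ((2 ^ Fintype.card V + x) /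
        (2 ^ Fintype.card V + x)) := by
  have h1 : star (graphState G) ⬝ᵥ (maxDepolarized G x *ᵥ graphState G) =
      (((1 + x) / (2 ^ Fintype.card V + x) : ℝ) : ℂ) := by
    rw [maxDepolarized, Matrix.smul_mulVec, Matrix.add_mulVec, Matrix.one_mulVec,
      Matrix.smul_mulVec, dotProduct_smul, dotProduct_add, dotProduct_smul,
      graphProj_expectation, star_graphState_dotProduct]
    push_cast
    simp only [smul_eq_mul]
    ring
  have h2 : (maxDepolarized G x).trace =
      (((2 ^ Fintype.card V + x) / (2 ^ Fintype.card V + x) : ℝ) : ℂ) := by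
    rw [maxDepolarized, Matrix.trace_smul, Matrix.trace_add, Matrix.trace_smul, graphProj_trace,
      Matrix.trace_one]
    push_cast
    simp only [smul_eq_mul, Fintype.card_fun, Fintype.card_fin]
    push_cast
    ring
  rw [fidelity, h1, h2, Complex.ofReal_re, Complex.ofReal_re]

theorem purifies_maxDepolarized_iff {a b : V} (hab : G.Adj a b) {x : ℝ} (hx : -1 ≤ x) :
    Purifies G (maxDepolarized G x) ↔
      1 / 3 + 1 / (3 * 2 ^ (Fintype.card V - 1)) <
        fidelity (graphState G) (maxDepolarized G x) := by
  obtain ⟨n, hn⟩ : ∃ n, Fintype.card V = n + 2 := ⟨_, (card_notMem_add_two hab.ne).symm⟩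
  have hm : ∀ {a b : V}, G.Adj a b → _ := fun hab => measuredPair_maxDepolarized (G := G) hab hx
  rw [fidelity_maxDepolarized]
  rw [hn] at hm ⊢
  have e1 : (2 : ℝ) ^ (n + 2) = 4 * 2 ^ n := by ring
  have e2 : (2 : ℝ) ^ (n + 2 - 1) = 2 * 2 ^ n := by
    rw [show n + 2 - 1 = n + 1 by omega]
    ring
  rw [e1] at hm
  rw [e1, e2]
  have hy1 : (1 : ℝ) ≤ 2 ^ n := one_le_pow₀ (by norm_num)
  generalize (2 : ℝ) ^ n = y at *
  have hpos : 0 < 4 * y + x := by linarith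
  have hiff : 1 / 3 + 1 / (3 * (2 * y)) < (1 + x) / (4 * y + x) / ((4 * y + x) / (4 * y + x)) ↔
      2 * y < x := by
    rw [div_self hpos.ne', div_one, lt_div_iff₀ hpos,
      show (1 / 3 + 1 / (3 * (2 * y))) * (4 * y + x) = (2 * y + 1) * (4 * y + x) / (6 * y) by
        field_simp; ring, div_lt_iff₀ (by linarith)]
    constructor
    · intro h
      by_contra hc
      nlinarith
    · intro h
      nlinarith
  rw [hiff]
  constructor
  · intro h
    by_contra hle
    refine not_purifies_of_partialTranspose G ?_ hab ?_ h
    · rintro ⟨e, he⟩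
      induction e with
      | _ a b =>
        have hab' : G.Adj a b := he
        simp only [hm hab']
        have hq : 0 ≤ 1 - x / (4 * y + x) := by
          rw [sub_nonneg, div_le_one hpos]
          linarith
        refine pairState_posSemidef mem_pair_cases ?_ (by linarith) (by linarith) (by linarith)
        have : 1 + x / (4 * y + x) + x / (4 * y + x) + x / (4 * y + x) =
            (4 * y + 4 * x) / (4 * y + x) := by
          field_simp
          ring
        rw [this]
        exact div_nonneg (by linarith) hpos.le
    · rw [hm hab, partialTranspose_pairState (by simpa using hab.ne) mem_pair_cases]
      have hq1 : 0 ≤ 1 + x / (4 * y + x) := by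
        rw [← neg_le_iff_add_nonneg', le_div_iff₀ hpos]
        linarith
      have hq2 : 3 * (x / (4 * y + x)) ≤ 1 := by
        rw [mul_div_assoc', div_le_one hpos]
        linarith
      exact pairState_posSemidef mem_pair_cases (by linarith) (by linarith) (by linarith)
        (by linarith)
  · intro h
    refine purifies_of_measuredPair fun a b hab => ⟨_, _, _, hm hab, ?_⟩
    have hq1 : x / (4 * y + x) ≤ 1 := by
      rw [div_le_one hpos]
      linarith
    have hq2 : 1 < 3 * (x / (4 * y + x)) := by
      rw [mul_div_assoc', one_lt_div hpos]
      linarith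
    exact ⟨by linarith, by linarith, by linarith, by linarith⟩

end Graph

/-! ### The graph of the Steane code -/

theorem steaneGraph_colorable : steaneGraph.Colorable 2 :=
  ⟨SimpleGraph.Coloring.mk (Sum.elim (fun _ => 0) fun _ => 1) (by
    rintro (a | a) (b | b) h
    · exact h.elim
    · simp
    · simp
    · exact h.elim)⟩

theorem steaneGraph_degree_le (v : Fin 3 ⊕ Fin 4) : steaneGraph.degree v ≤ 3 := by
  revert v
  decide

theorem steaneGraph_maxDegree : steaneGraph.maxDegree = 3 := by
  decide

end DRPP

theorem mainTheorem8 {V : Type*} [Fintype V] [DecidableEq V]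
    (G : SimpleGraph V) [DecidableRel G.Adj] :
    -- the critical error rate is well defined by the polynomial
    (∀ D : ℕ, ∃! pc : ℝ, DRPP.IsCriticalRate D pc) ∧
    -- local depolarizing noise on a two-colorable graph without vertices of degree above `D`
    (∀ (D : ℕ) (pc : ℝ), G.Colorable 2 → (∀ v, G.degree v ≤ D) → DRPP.IsCriticalRate D pc →
      (∀ p : ℝ, 0 ≤ p → p < pc →
        DRPP.Purifies G (DRPP.localDepolarize p (DRPP.graphProj G))) ∧
      ((∃ a b, G.Adj a b ∧ G.degree a = D ∧ G.degree b = D) →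
        ∀ p : ℝ, pc ≤ p → p ≤ 1 →
          ¬ DRPP.Purifies G (DRPP.localDepolarize p (DRPP.graphProj G)))) ∧
    -- the Steane code
    (DRPP.steaneGraph.Colorable 2 ∧ DRPP.steaneGraph.maxDegree = 3 ∧
      ∀ pc : ℝ, DRPP.IsCriticalRate 3 pc →
        |pc - 0.16| < 0.0005 ∧
        ∀ p : ℝ, 0 ≤ p → p ≤ 1 →
          (DRPP.Purifies DRPP.steaneGraph
            (DRPP.localDepolarize p (DRPP.graphProj DRPP.steaneGraph)) ↔ p < pc)) ∧
    -- maximally depolarizing noise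
    ((∃ a b, G.Adj a b) → ∀ x : ℝ, -1 ≤ x →
      (DRPP.Purifies G (DRPP.maxDepolarized G x) ↔
        1 / 3 + 1 / (3 * 2 ^ (Fintype.card V - 1)) <
          DRPP.fidelity (DRPP.graphState G) (DRPP.maxDepolarized G x))) := by
  refine ⟨DRPP.existsUnique_isCriticalRate, ?_, ⟨DRPP.steaneGraph_colorable,
    DRPP.steaneGraph_maxDegree, fun pc hpc => ⟨DRPP.criticalRate_three_near hpc,
      fun p h₀ h₁ => ⟨fun h => ?_, fun h => ?_⟩⟩⟩, ?_⟩
  · intro D pc hG hD hpc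
    refine ⟨fun p h₀ hp => DRPP.purifies_localDepolarize hG hD hpc h₀ hp, ?_⟩
    rintro ⟨a, b, hab, ha, hb⟩ p hp h₁
    exact DRPP.not_purifies_localDepolarize hG hpc hab ha hb hp h₁
  · by_contra hp
    exact DRPP.not_purifies_localDepolarize DRPP.steaneGraph_colorable hpc
      (a := Sum.inl 0) (b := Sum.inr 3) (by decide) (by decide) (by decide) (not_lt.mp hp) h₁ h
  · exact DRPP.purifies_localDepolarize DRPP.steaneGraph_colorable DRPP.steaneGraph_degree_le
      hpc h₀ h
  · rintro ⟨a, b, hab⟩ x hx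
    exact DRPP.purifies_maxDepolarized_iff hab hx
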